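/- Let $k\ge 1$. A $k$-graph is a countable small category $\Lambda$ (identified with its set of morphisms, with range and source maps $r,s$, and with $\mu\nu$ defined when $s(\mu)=r(\nu)$) together with a degree functor $d:\Lambda\to\mathbb N^k$ such that whenever $d(\lambda)=m+n$ there are unique $\mu,\nu\in\Lambda$ with $d(\mu)=m$, $d(\nu)=n$ and $\lambda=\mu\nu$. Write $\Lambda^n=d^{-1}(n)$, so that $\Lambda^0$ is the set of vertices, and $vE=\{\lambda\in E: r(\lambda)=v\}$. Let $e_1,\dots,e_k$ be the standard generators of $\mathbb N^k$, and let $\wedge$ and $\le$ be taken coordinatewise. $\Lambda$ is row-finite if every $v\Lambda^n$ ($v\in\Lambda^0$, $n\in\mathbb N^k$) is finite, and locally convex if for all $v\in\Lambda^0$, $i\ne j$, $\lambda\in v\Lambda^{e_i}$, $\mu\in v\Lambda^{e_j}$ one has $s(\lambda)\Lambda^{e_j}\neq\emptyset$ and $s(\mu)\Lambda^{e_i}\ne\emptyset$. For $m\in(\mathbb N\cup\{\infty\})^k$ let $\Omega_{k,m}=\{(p,q)\in\mathbb N^k\times\mathbb N^k:p\le q\le m\}$ be the $k$-graph with $r(p,q)=(p,p)$,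 $s(p,q)=(q,q)$, $(p,q)(q,t)=(p,t)$, $d(p,q)=q-p$. A boundary path in $\Lambda$ is a degree-preserving functor $x:\Omega_{k,m}\to\Lambda$ such that $p\le m$ and $p_i=m_i$ imply $x(p)\Lambda^{e_i}=\emptyset$, where $x(p)=x(p,p)$; write $d(x)=m$, and let $\Lambda^{\le\infty}$ be the set of boundary paths. For $n\le d(x)$ the shift $\sigma^n(x)$ is the path of degree $d(x)-n$ with $\sigma^n(x)(p,q)=x(p+n,q+n)$. For $\lambda\in\Lambda$ with $s(\lambda)=x(0)$, $\lambda x$ is the path of degree $d(\lambda)+d(x)$ with $(\lambda x)(0,d(\lambda))=\lambda$ and $\sigma^{d(\lambda)}(\lambda x)=x$. Write $\mu\sim_\Lambda\nu$ if $s(\mu)=s(\nu)$ and $\mu x=\nu x$ for all $x\in\Lambda^{\le\infty}$ with $x(0)=s(\mu)$, and put $$\mathrm{Per}(\Lambda)=\{d(\mu)-d(\nu):\mu,\nu\in\Lambda,\ \mu\sim_\Lambda\nu\}\subseteq\mathbb Z^k.$$ The desourcification $\overline\Lambda$ of a locally convex row-finite $k$-graph $\Lambda$ is the $k$-graph of classes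 $[x;(m,n)]$ of pairs $(x;(m,n))$ with $x\in\Lambda^{\le\infty}$ and $m\le n$ in $\mathbb N^k$, where $(x;(m,n))\approx(y;(p,q))$ if and only if $x(m\wedge d(x),n\wedge d(x))=y(p\wedge d(y),q\wedge d(y))$, $m-m\wedge d(x)=p-p\wedge d(y)$ and $n-m=q-p$, with $$r([x;(m,n)])=[x;(m,m)],\quad s([x;(m,n)])=[x;(n,n)],\quad d([x;(m,n)])=n-m,$$ $$[x;(m,n)]\circ[y;(p,q)]=[x(0,n\wedge d(x))\,\sigma^{p\wedge d(y)}(y);(m,n+q-p)]\quad\text{if } [x;(n,n)]=[y;(p,p)].$$ A maximal tail in $\Lambda$ is a nonempty set $T\subseteq\Lambda^0$ such that (1) $s(\lambda)\in T$ implies $r(\lambda)\in T$ for all $\lambda\in\Lambda$; (2) for all $v\in T$ and $n\in\mathbb N^k$ there is $\lambda\in v\Lambda^{\le n}$ with $s(\lambda)\in T$, where $\Lambda^{\le n}$ is the set of $\lambda\in\Lambda$ with $d(\lambda)\le n$ such that $d(\lambda)_i<n_i$ implies $s(\lambda)\Lambda^{e_i}=\emptyset$; (3) for all $v,w\in T$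 there are $\mu\in v\Lambda$ and $\nu\in w\Lambda$ with $s(\mu)=s(\nu)$. **Corollary 3.7.** Let $\Lambda$ be a locally convex row-finite $k$-graph and let $\overline\Lambda$ be its desourcification. Then $\mathrm{Per}(\Lambda)=\mathrm{Per}(\overline\Lambda)$. Moreover, if $\Lambda^0$ is a maximal tail in $\Lambda$, then $\mathrm{Per}(\Lambda)$ is a subgroup of $\mathbb Z^k$. -/

import Mathlib

universe u

/-- A `k`-graph: a countable small category, presented by its set `Path` of morphisms (a vertex is
identified with its identity morphism, so `r` and `s` take values in `Path`), together with a degree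
functor `d` to `ℕ^k` that has the unique factorization property. The composition `comp μ ν = μν`
is defined exactly when `s μ = r ν`. -/
structure KGraph (k : ℕ) where
  Path : Type u
  countable_path : Countable Path
  r : Path → Path
  s : Path → Path
  r_r : ∀ l, r (r l) = r l
  s_r : ∀ l, s (r l) = r l
  r_s : ∀ l, r (s l) = s l
  s_s : ∀ l, s (s l) = s l
  comp : ∀ μ ν : Path, s μ = r ν → Path
  r_comp : ∀ μ ν h, r (comp μ ν h) = r μ
  s_comp : ∀ μ ν h, s (comp μ ν h) = s ν
  id_comp : ∀ l, comp (r l) l (s_r l) = l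
  comp_id : ∀ l, comp l (s l) (r_s l).symm = l
  assoc : ∀ (l μ ν : Path) (h₁ : s l = r μ) (h₂ : s μ = r ν),
    comp (comp l μ h₁) ν ((s_comp l μ h₁).trans h₂) =
      comp l (comp μ ν h₂) (h₁.trans (r_comp μ ν h₂).symm)
  d : Path → (Fin k → ℕ)
  d_r : ∀ l, d (r l) = 0
  d_s : ∀ l, d (s l) = 0
  d_comp : ∀ μ ν h, d (comp μ ν h) = d μ + d ν
  factorization : ∀ (l : Path) (m n : Fin k → ℕ), d l = m + n →
    ∃! p : Path × Path, d p.1 = m ∧ d p.2 = n ∧ ∃ h : s p.1 = r p.2, l = comp p.1 p.2 h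

namespace KGraph

variable {k : ℕ}

/-- The vertices `Λ^0 = d⁻¹(0)`. -/
def vertices (Λ : KGraph.{u} k) : Set Λ.Path := {v | Λ.d v = 0}

/-- `vΛ^{e_i} ≠ ∅`. -/
def HasEdge (Λ : KGraph.{u} k) (v : Λ.Path) (i : Fin k) : Prop :=
  ∃ l, Λ.r l = v ∧ Λ.d l = Pi.single i 1

/-- All the sets `vΛ^n` are finite. -/
def RowFinite (Λ : KGraph.{u} k) : Prop :=
  ∀ v ∈ Λ.vertices, ∀ n : Fin k → ℕ, {l | Λ.r l = v ∧ Λ.d l = n}.Finite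

def LocallyConvex (Λ : KGraph.{u} k) : Prop :=
  ∀ v ∈ Λ.vertices, ∀ i j : Fin k, i ≠ j → ∀ l μ : Λ.Path,
    Λ.r l = v → Λ.d l = Pi.single i 1 → Λ.r μ = v → Λ.d μ = Pi.single j 1 →
      Λ.HasEdge (Λ.s l) j ∧ Λ.HasEdge (Λ.s μ) i

/-- The set `Λ^{≤ n}`. -/
def pathsLE (Λ : KGraph.{u} k) (n : Fin k → ℕ) : Set Λ.Path :=
  {l | Λ.d l ≤ n ∧ ∀ i, Λ.d l i < n i → ¬ Λ.HasEdge (Λ.s l) i}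

/-- Maximal tails. -/
structure IsMaximalTail (Λ : KGraph.{u} k) (T : Set Λ.Path) : Prop where
  subset_vertices : T ⊆ Λ.vertices
  nonempty : T.Nonempty
  range_mem : ∀ l, Λ.s l ∈ T → Λ.r l ∈ T
  exists_pathsLE : ∀ v ∈ T, ∀ n : Fin k → ℕ, ∃ l ∈ Λ.pathsLE n, Λ.r l = v ∧ Λ.s l ∈ T
  directed : ∀ v ∈ T, ∀ w ∈ T, ∃ μ ν, Λ.r μ = v ∧ Λ.r ν = w ∧ Λ.s μ = Λ.s ν

/-! ### Segments of a path -/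

section Segments

variable (Λ : KGraph.{u} k)

theorem comp_congr {Λ : KGraph.{u} k} {μ μ' ν ν' : Λ.Path} (h₁ : μ = μ') (h₂ : ν = ν')
    (h : Λ.s μ = Λ.r ν) (h' : Λ.s μ' = Λ.r ν') : Λ.comp μ ν h = Λ.comp μ' ν' h' := by
  subst h₁; subst h₂; rfl

theorem comp_inj {Λ : KGraph.{u} k} {μ ν μ' ν' : Λ.Path} (h : Λ.s μ = Λ.r ν)
    (h' : Λ.s μ' = Λ.r ν') (hd : Λ.d μ = Λ.d μ') (he : Λ.comp μ ν h = Λ.comp μ' ν' h') :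
    μ = μ' ∧ ν = ν' := by
  have hd2 : Λ.d ν = Λ.d ν' := by
    have := congrArg Λ.d he
    rw [Λ.d_comp, Λ.d_comp, hd] at this
    exact add_left_cancel this
  have := (Λ.factorization (Λ.comp μ ν h) (Λ.d μ) (Λ.d ν) (Λ.d_comp _ _ _)).unique
    (y₁ := (μ, ν)) (y₂ := (μ', ν')) ⟨rfl, rfl, h, rfl⟩ ⟨hd.symm, hd2.symm, h', he⟩
  exact ⟨congrArg Prod.fst this, congrArg Prod.snd this⟩

theorem r_eq_self {v : Λ.Path} (hv : Λ.d v = 0) : Λ.r v = v := by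
  refine (comp_inj (Λ.s_r v) (Λ.r_s v).symm ?_ ((Λ.id_comp v).trans (Λ.comp_id v).symm)).1
  rw [Λ.d_r, hv]

theorem s_eq_self {v : Λ.Path} (hv : Λ.d v = 0) : Λ.s v = v := by
  rw [← Λ.r_eq_self hv, Λ.s_r]

theorem exists_factor (l : Λ.Path) (m : Fin k → ℕ) (h : m ≤ Λ.d l) :
    ∃ p : Λ.Path × Λ.Path, Λ.d p.1 = m ∧ Λ.d p.2 = Λ.d l - m ∧
      ∃ h : Λ.s p.1 = Λ.r p.2, l = Λ.comp p.1 p.2 h :=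
  (Λ.factorization l m (Λ.d l - m) (add_tsub_cancel_of_le h).symm).exists

/-- The initial segment of degree `m` of a path. -/
noncomputable def head (l : Λ.Path) (m : Fin k → ℕ) (h : m ≤ Λ.d l) : Λ.Path :=
  (Λ.exists_factor l m h).choose.1

/-- What remains of a path after its initial segment of degree `m`. -/
noncomputable def tail (l : Λ.Path) (m : Fin k → ℕ) (h : m ≤ Λ.d l) : Λ.Path :=
  (Λ.exists_factor l m h).choose.2

theorem d_head (l : Λ.Path) (m : Fin k → ℕ) (h : m ≤ Λ.d l) : Λ.d (Λ.head l m h) = m :=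
  (Λ.exists_factor l m h).choose_spec.1

theorem d_tail (l : Λ.Path) (m : Fin k → ℕ) (h : m ≤ Λ.d l) :
    Λ.d (Λ.tail l m h) = Λ.d l - m :=
  (Λ.exists_factor l m h).choose_spec.2.1

theorem s_head (l : Λ.Path) (m : Fin k → ℕ) (h : m ≤ Λ.d l) :
    Λ.s (Λ.head l m h) = Λ.r (Λ.tail l m h) :=
  (Λ.exists_factor l m h).choose_spec.2.2.choose

theorem head_comp_tail (l : Λ.Path) (m : Fin k → ℕ) (h : m ≤ Λ.d l) :
    Λ.comp (Λ.head l m h) (Λ.tail l m h) (Λ.s_head l m h) = l :=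
  (Λ.exists_factor l m h).choose_spec.2.2.choose_spec.symm

theorem head_eq {l μ ν : Λ.Path} (h : Λ.s μ = Λ.r ν) (hl : l = Λ.comp μ ν h)
    {m : Fin k → ℕ} (hm : m ≤ Λ.d l) (hd : Λ.d μ = m) : Λ.head l m hm = μ :=
  (comp_inj (Λ.s_head l m hm) h ((Λ.d_head l m hm).trans hd.symm)
    ((Λ.head_comp_tail l m hm).trans hl)).1

theorem tail_eq {l μ ν : Λ.Path} (h : Λ.s μ = Λ.r ν) (hl : l = Λ.comp μ ν h)
    {m : Fin k → ℕ} (hm : m ≤ Λ.d l) (hd : Λ.d μ = m) : Λ.tail l m hm = ν :=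
  (comp_inj (Λ.s_head l m hm) h ((Λ.d_head l m hm).trans hd.symm)
    ((Λ.head_comp_tail l m hm).trans hl)).2

/-- The segment `l(p, q)` of a path `l`, for `p ≤ q ≤ d l`: the middle factor of the factorization
of `l` into paths of degrees `p`, `q - p` and `d l - q`. -/
noncomputable def segment (l : Λ.Path) (p q : Fin k → ℕ) (hpq : p ≤ q) (hq : q ≤ Λ.d l) :
    Λ.Path :=
  Λ.tail (Λ.head l q hq) p (hpq.trans (Λ.d_head l q hq).ge)

theorem segment_eq {l α β γ : Λ.Path} (h₁ : Λ.s α = Λ.r β) (h₂ : Λ.s β = Λ.r γ)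
    (hl : l = Λ.comp (Λ.comp α β h₁) γ ((Λ.s_comp α β h₁).trans h₂))
    {p q : Fin k → ℕ} (hpq : p ≤ q) (hq : q ≤ Λ.d l) (hp : Λ.d α = p)
    (hq' : Λ.d α + Λ.d β = q) : Λ.segment l p q hpq hq = β := by
  have hh : Λ.head l q hq = Λ.comp α β h₁ := Λ.head_eq _ hl hq (by rw [Λ.d_comp, hq'])
  exact Λ.tail_eq h₁ hh _ hp

theorem exists_segment (l : Λ.Path) (p q : Fin k → ℕ) (hpq : p ≤ q) (hq : q ≤ Λ.d l) :
    ∃ (α γ : Λ.Path) (h₁ : Λ.s α = Λ.r (Λ.segment l p q hpq hq))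
      (h₂ : Λ.s (Λ.segment l p q hpq hq) = Λ.r γ),
      l = Λ.comp (Λ.comp α _ h₁) γ ((Λ.s_comp α _ h₁).trans h₂) ∧ Λ.d α = p := by
  have hp : p ≤ Λ.d (Λ.head l q hq) := hpq.trans (Λ.d_head l q hq).ge
  refine ⟨Λ.head (Λ.head l q hq) p hp, Λ.tail l q hq, Λ.s_head _ _ _, ?_, ?_, Λ.d_head _ _ _⟩
  · rw [← Λ.s_head l q hq]
    conv_rhs => rw [← Λ.head_comp_tail (Λ.head l q hq) p hp, Λ.s_comp]
    rfl
  · conv_lhs => rw [← Λ.head_comp_tail l q hq]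
    exact comp_congr (Λ.head_comp_tail _ p hp).symm rfl _ _

theorem d_segment (l : Λ.Path) (p q : Fin k → ℕ) (hpq : p ≤ q) (hq : q ≤ Λ.d l) :
    Λ.d (Λ.segment l p q hpq hq) = q - p := by
  rw [segment, Λ.d_tail, Λ.d_head]

theorem segment_congr {l l' : Λ.Path} (hl : l = l') {p p' q q' : Fin k → ℕ} (hp : p = p')
    (hqq : q = q') (hpq : p ≤ q) (hq : q ≤ Λ.d l) (hpq' : p' ≤ q') (hq' : q' ≤ Λ.d l') :
    Λ.segment l p q hpq hq = Λ.segment l' p' q' hpq' hq' := by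
  subst hl hp hqq; rfl

/-- A segment of an initial part of a path is a segment of the path. -/
theorem segment_comp (a b : Λ.Path) (h : Λ.s a = Λ.r b) (p q : Fin k → ℕ) (hpq : p ≤ q)
    (hq : q ≤ Λ.d (Λ.comp a b h)) (hq' : q ≤ Λ.d a) :
    Λ.segment (Λ.comp a b h) p q hpq hq = Λ.segment a p q hpq hq' := by
  obtain ⟨α, γ, h₁, h₂, e, hd⟩ := Λ.exists_segment a p q hpq hq'
  have h3 : Λ.s γ = Λ.r b := by rw [← h, e, Λ.s_comp]
  refine Λ.segment_eq (γ := Λ.comp γ b h3) h₁ (by rw [Λ.r_comp, h₂]) ?_ hpq hq hd ?_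
  · rw [← Λ.assoc]
    exact comp_congr e rfl _ _
  · rw [hd, Λ.d_segment, add_tsub_cancel_of_le hpq]

theorem segment_segment_comp (l : Λ.Path) (p q t : Fin k → ℕ) (hpq : p ≤ q) (hqt : q ≤ t)
    (ht : t ≤ Λ.d l) :
    ∃ h : Λ.s (Λ.segment l p q hpq (hqt.trans ht)) = Λ.r (Λ.segment l q t hqt ht),
      Λ.comp _ _ h = Λ.segment l p t (hpq.trans hqt) ht := by
  obtain ⟨α, γ, h₁, h₂, e, hd⟩ := Λ.exists_segment l q t hqt ht
  obtain ⟨α', γ', h₁', h₂', e', hd'⟩ := Λ.exists_segment α p q hpq hd.ge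
  have hγ' : Λ.d γ' = 0 := by
    have := congrArg Λ.d e'
    rw [Λ.d_comp, Λ.d_comp, hd', Λ.d_segment, add_tsub_cancel_of_le hpq] at this
    exact left_eq_add.mp (hd.symm.trans this)
  have hsg : Λ.segment α p q hpq hd.ge = Λ.segment l p q hpq (hqt.trans ht) := by
    have e2 : l = Λ.comp α (Λ.comp _ γ h₂) (h₁.trans (Λ.r_comp _ _ _).symm) := by
      rw [← Λ.assoc]; exact e
    rw [← Λ.segment_comp α _ (h₁.trans (Λ.r_comp _ _ _).symm) p q hpq
      ((hqt.trans ht).trans (by rw [← e2])) hd.ge]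
    exact Λ.segment_congr e2.symm rfl rfl _ _ _ _
  have e3 : α = Λ.comp α' _ h₁' := by
    conv_lhs => rw [e']
    have : γ' = Λ.s (Λ.comp α' _ h₁') := by
      rw [Λ.s_comp, h₂', Λ.r_eq_self hγ']
    rw [comp_congr rfl this _ (Λ.r_s _).symm, Λ.comp_id]
  have h4 : Λ.s (Λ.segment α p q hpq hd.ge) = Λ.r (Λ.segment l q t hqt ht) := by
    rw [← h₁]; conv_rhs => rw [e3, Λ.s_comp]
  refine ⟨hsg ▸ h4, ?_⟩
  rw [comp_congr hsg.symm rfl _ h4]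
  refine (Λ.segment_eq (α := α') (γ := γ) (h₁'.trans (Λ.r_comp _ _ h4).symm)
    ((Λ.s_comp _ _ h4).trans h₂) ?_ _ _ hd' ?_).symm
  · conv_lhs => rw [e]
    refine comp_congr ?_ rfl _ _
    rw [← Λ.assoc _ _ _ h₁' h4]
    exact comp_congr e3 rfl _ _
  · rw [hd', Λ.d_comp, Λ.d_segment, Λ.d_segment, ← add_assoc, add_tsub_cancel_of_le hpq,
      add_tsub_cancel_of_le hqt]

theorem s_segment (l : Λ.Path) (p q : Fin k → ℕ) (hpq : p ≤ q) (hq : q ≤ Λ.d l) :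
    Λ.s (Λ.segment l p q hpq hq) = Λ.segment l q q le_rfl hq := by
  obtain ⟨h, -⟩ := Λ.segment_segment_comp l p q q hpq le_rfl hq
  rw [h, Λ.r_eq_self]
  rw [Λ.d_segment, tsub_self]

theorem r_segment (l : Λ.Path) (p q : Fin k → ℕ) (hpq : p ≤ q) (hq : q ≤ Λ.d l) :
    Λ.r (Λ.segment l p q hpq hq) = Λ.segment l p p le_rfl (hpq.trans hq) := by
  obtain ⟨h, -⟩ := Λ.segment_segment_comp l p p q le_rfl hpq hq
  rw [← h, Λ.s_eq_self]
  rw [Λ.d_segment, tsub_self]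

end Segments

/-! ### Paths of possibly infinite degree, boundary paths -/

/-- `n ∈ ℕ^k` as an element of `(ℕ ∪ {∞})^k`. -/
def toENat (n : Fin k → ℕ) : Fin k → ℕ∞ := fun i => (n i : ℕ∞)

theorem toENat_mono {m n : Fin k → ℕ} (h : m ≤ n) : toENat m ≤ toENat n :=
  fun i => Nat.cast_le.mpr (h i)

/-- A degree preserving functor `Ω_{k,deg} → Λ`, where `Ω_{k,m} = {(p, q) : p ≤ q ≤ m}`, with
`r (p, q) = (p, p)`, `s (p, q) = (q, q)`, `(p, q)(q, t) = (p, t)` and `d (p, q) = q - p`; the value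
at `(p, q)` is `seg p q`. -/
structure ExtPath (Λ : KGraph.{u} k) where
  deg : Fin k → ℕ∞
  seg : ∀ p q : Fin k → ℕ, p ≤ q → toENat q ≤ deg → Λ.Path
  r_seg : ∀ p q (hpq : p ≤ q) (hq : toENat q ≤ deg),
    Λ.r (seg p q hpq hq) = seg p p le_rfl ((toENat_mono hpq).trans hq)
  s_seg : ∀ p q (hpq : p ≤ q) (hq : toENat q ≤ deg),
    Λ.s (seg p q hpq hq) = seg q q le_rfl hq
  d_seg : ∀ p q (hpq : p ≤ q) (hq : toENat q ≤ deg), Λ.d (seg p q hpq hq) = q - p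
  seg_comp : ∀ p q t (hpq : p ≤ q) (hqt : q ≤ t) (ht : toENat t ≤ deg),
    Λ.comp (seg p q hpq ((toENat_mono hqt).trans ht)) (seg q t hqt ht)
      ((s_seg p q hpq _).trans (r_seg q t hqt ht).symm) = seg p t (hpq.trans hqt) ht

namespace ExtPath

variable {Λ : KGraph.{u} k}

/-- The vertex `x(p)`, for `p ≤ d(x)`. -/
def vertex (x : Λ.ExtPath) (p : Fin k → ℕ) (hp : toENat p ≤ x.deg) : Λ.Path :=
  x.seg p p le_rfl hp

theorem zero_le_deg (x : Λ.ExtPath) : toENat (0 : Fin k → ℕ) ≤ x.deg := fun i => by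
  simp [toENat]

/-- The range `x(0)`. -/
def range (x : Λ.ExtPath) : Λ.Path := x.vertex 0 x.zero_le_deg

/-- `x` is a boundary path: whenever `p ≤ d(x)` and `p_i = d(x)_i`, one has
`x(p)Λ^{e_i} = ∅`. -/
def IsBoundary (x : Λ.ExtPath) : Prop :=
  ∀ (p : Fin k → ℕ) (hp : toENat p ≤ x.deg) (i : Fin k), (p i : ℕ∞) = x.deg i →
    ¬ Λ.HasEdge (x.vertex p hp) i

theorem ext_seg {x y : Λ.ExtPath} (hd : x.deg = y.deg)
    (h : ∀ p q hpq hx hy, x.seg p q hpq hx = y.seg p q hpq hy) : x = y := by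
  cases x; cases y
  cases hd
  congr
  funext p q hpq hq
  exact h p q hpq hq hq

theorem seg_congr (x : Λ.ExtPath) {p p' q q' : Fin k → ℕ} (hp : p = p') (hqq : q = q')
    (hpq : p ≤ q) (hq : toENat q ≤ x.deg) (hpq' : p' ≤ q') (hq' : toENat q' ≤ x.deg) :
    x.seg p q hpq hq = x.seg p' q' hpq' hq' := by
  subst hp hqq; rfl

theorem segment_seg (x : Λ.ExtPath) (t p q : Fin k → ℕ) (ht : toENat t ≤ x.deg) (hpq : p ≤ q)
    (hqt : q ≤ t) (hq : q ≤ Λ.d (x.seg 0 t (fun _ => Nat.zero_le _) ht)) :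
    Λ.segment (x.seg 0 t (fun _ => Nat.zero_le _) ht) p q hpq hq =
      x.seg p q hpq ((toENat_mono hqt).trans ht) := by
  have hq' := (toENat_mono hqt).trans ht
  refine Λ.segment_eq (α := x.seg 0 p (fun _ => Nat.zero_le _) ((toENat_mono hpq).trans hq'))
    (γ := x.seg q t hqt ht) ((x.s_seg _ _ _ _).trans (x.r_seg _ _ _ _).symm)
    ((x.s_seg _ _ _ _).trans (x.r_seg _ _ _ _).symm) ?_ _ _ ?_ ?_
  · rw [← x.seg_comp 0 q t (fun _ => Nat.zero_le _) hqt ht]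
    exact comp_congr (x.seg_comp 0 p q (fun _ => Nat.zero_le _) hpq hq').symm rfl _ _
  · rw [x.d_seg, tsub_zero]
  · rw [x.d_seg, x.d_seg, tsub_zero, add_tsub_cancel_of_le hpq]

theorem add_le_deg {D : Fin k → ℕ∞} {n q : Fin k → ℕ} (hn : toENat n ≤ D)
    (hq : toENat q ≤ D - toENat n) : toENat (q + n) ≤ D := fun i => by
  have h1 := hn i
  have h2 := hq i
  simp only [toENat, Pi.sub_apply, Pi.add_apply, Nat.cast_add] at *
  calc (q i : ℕ∞) + n i ≤ (D i - n i) + n i := by gcongr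
    _ = D i := tsub_add_cancel_of_le h1

/-- The shift `σ^n(x)`, for `n ≤ d(x)`. -/
def shift (x : Λ.ExtPath) (n : Fin k → ℕ) (hn : toENat n ≤ x.deg) : Λ.ExtPath where
  deg := x.deg - toENat n
  seg p q hpq hq := x.seg (p + n) (q + n) (add_le_add_left hpq n) (add_le_deg hn hq)
  r_seg p q hpq hq := x.r_seg _ _ _ _
  s_seg p q hpq hq := x.s_seg _ _ _ _
  d_seg p q hpq hq := by rw [x.d_seg, add_tsub_add_eq_tsub_right]
  seg_comp p q t hpq hqt ht := x.seg_comp _ _ _ _ _ _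

theorem range_shift (x : Λ.ExtPath) (n : Fin k → ℕ) (hn : toENat n ≤ x.deg) :
    (x.shift n hn).range = x.vertex n hn :=
  x.seg_congr (zero_add n) (zero_add n) _ _ _ _

theorem sub_le_deg {D : Fin k → ℕ∞} {n q : Fin k → ℕ} (hq : toENat q ≤ toENat n + D) :
    toENat (q - n) ≤ D := fun i => by
  have h := hq i
  simp only [toENat, Pi.sub_apply, Pi.add_apply, ENat.natCast_sub] at *
  exact tsub_le_iff_left.mpr h

theorem zero_le' (n : Fin k → ℕ) : 0 ≤ n := fun _ => Nat.zero_le _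

/-- The finite path `l x(0, t)`. -/
def compInit (l : Λ.Path) (x : Λ.ExtPath) (h : Λ.s l = x.range) (t : Fin k → ℕ)
    (ht : toENat t ≤ x.deg) : Λ.Path :=
  Λ.comp l (x.seg 0 t (zero_le' t) ht) (h.trans (x.r_seg _ _ _ _).symm)

theorem d_compInit (l : Λ.Path) (x : Λ.ExtPath) (h : Λ.s l = x.range) (t : Fin k → ℕ)
    (ht : toENat t ≤ x.deg) : Λ.d (compInit l x h t ht) = Λ.d l + t := by
  rw [compInit, Λ.d_comp, x.d_seg, tsub_zero]

theorem compInit_segment (l : Λ.Path) (x : Λ.ExtPath) (h : Λ.s l = x.range)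
    (t t' p q : Fin k → ℕ) (htt : t ≤ t') (ht : toENat t' ≤ x.deg) (hpq : p ≤ q)
    (hq' : q ≤ Λ.d (compInit l x h t' ht))
    (hq : q ≤ Λ.d (compInit l x h t ((toENat_mono htt).trans ht))) :
    Λ.segment (compInit l x h t' ht) p q hpq hq' =
      Λ.segment (compInit l x h t ((toENat_mono htt).trans ht)) p q hpq hq := by
  have h2 : Λ.s (compInit l x h t ((toENat_mono htt).trans ht)) = Λ.r (x.seg t t' htt ht) := by
    rw [compInit, Λ.s_comp, x.s_seg, x.r_seg]
  have e : compInit l x h t' ht = Λ.comp _ _ h2 := by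
    unfold compInit
    rw [Λ.assoc]
    exact comp_congr rfl (x.seg_comp 0 t t' (zero_le' t) htt ht).symm _ _
  rw [← Λ.segment_comp _ _ h2 p q hpq (hq'.trans (by rw [e])) hq]
  exact Λ.segment_congr e rfl rfl _ _ _ _

theorem le_d_compInit (l : Λ.Path) (x : Λ.ExtPath) (h : Λ.s l = x.range) {q t : Fin k → ℕ}
    (hqt : q ≤ t) (ht : toENat t ≤ toENat (Λ.d l) + x.deg) :
    q ≤ Λ.d (compInit l x h (t - Λ.d l) (sub_le_deg ht)) := by
  rw [d_compInit]
  exact hqt.trans le_add_tsub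

theorem concat_aux (l : Λ.Path) (x : Λ.ExtPath) (h : Λ.s l = x.range) {p q t : Fin k → ℕ}
    (hpq : p ≤ q) (hqt : q ≤ t) (ht : toENat t ≤ toENat (Λ.d l) + x.deg) :
    Λ.segment (compInit l x h (q - Λ.d l) (sub_le_deg ((toENat_mono hqt).trans ht))) p q hpq
      (le_d_compInit l x h le_rfl ((toENat_mono hqt).trans ht)) =
    Λ.segment (compInit l x h (t - Λ.d l) (sub_le_deg ht)) p q hpq
      (le_d_compInit l x h hqt ht) :=
  (compInit_segment l x h _ _ p q (tsub_le_tsub_right hqt _) _ hpq _ _).symm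

/-- The concatenation `l x`, for `s l = x(0)`: its `(p, q)`-segment is that of the finite path
`l x(0, t)` with `t = (q - d(l)) ∨ 0`. -/
noncomputable def concat (l : Λ.Path) (x : Λ.ExtPath) (h : Λ.s l = x.range) : Λ.ExtPath where
  deg := toENat (Λ.d l) + x.deg
  seg p q hpq hq := Λ.segment (compInit l x h (q - Λ.d l) (sub_le_deg hq)) p q hpq
    (le_d_compInit l x h le_rfl hq)
  r_seg p q hpq hq := by
    rw [Λ.r_segment, concat_aux l x h le_rfl hpq hq]
  s_seg p q hpq hq := Λ.s_segment _ _ _ _ _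
  d_seg p q hpq hq := Λ.d_segment _ _ _ _ _
  seg_comp p q t hpq hqt ht := by
    obtain ⟨h', e⟩ := Λ.segment_segment_comp (compInit l x h (t - Λ.d l) (sub_le_deg ht)) p q t
      hpq hqt (le_d_compInit l x h le_rfl ht)
    rw [← e]
    exact comp_congr (concat_aux l x h hpq hqt ht) rfl _ _

theorem d_le_concat (l : Λ.Path) (x : Λ.ExtPath) (h : Λ.s l = x.range) :
    toENat (Λ.d l) ≤ (concat l x h).deg := fun i => by
  change _ ≤ toENat (Λ.d l) i + x.deg i
  exact le_self_add

/-- Segments of `l x` inside `l`. -/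
theorem concat_seg_left (l : Λ.Path) (x : Λ.ExtPath) (h : Λ.s l = x.range) {p q : Fin k → ℕ}
    (hpq : p ≤ q) (hq : q ≤ Λ.d l) (hq' : toENat q ≤ (concat l x h).deg) :
    (concat l x h).seg p q hpq hq' = Λ.segment l p q hpq hq :=
  Λ.segment_comp _ _ _ _ _ _ _ _

/-- Segments of `l x` inside `x`. -/
theorem concat_seg_right (l : Λ.Path) (x : Λ.ExtPath) (h : Λ.s l = x.range) {p q : Fin k → ℕ}
    (hpq : p ≤ q) (hq : toENat q ≤ x.deg) (hpq' : Λ.d l + p ≤ Λ.d l + q)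
    (hq' : toENat (Λ.d l + q) ≤ (concat l x h).deg) :
    (concat l x h).seg (Λ.d l + p) (Λ.d l + q) hpq' hq' = x.seg p q hpq hq := by
  have e : Λ.d l + q - Λ.d l = q := add_tsub_cancel_left _ _
  have hp : toENat p ≤ x.deg := (toENat_mono hpq).trans hq
  have e0 : compInit l x h (Λ.d l + q - Λ.d l) (sub_le_deg hq') = compInit l x h q hq := by
    unfold compInit
    exact comp_congr rfl (x.seg_congr rfl e _ _ _ _) _ _
  have h1 : Λ.s (compInit l x h p hp) = Λ.r (x.seg p q hpq hq) := by
    rw [compInit, Λ.s_comp, x.s_seg, x.r_seg]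
  have e1 : compInit l x h q hq = Λ.comp _ _ h1 := by
    unfold compInit
    rw [Λ.assoc]
    exact comp_congr rfl (x.seg_comp 0 p q (zero_le' p) hpq hq).symm _ _
  refine Λ.segment_eq (α := compInit l x h p hp) (γ := Λ.s (x.seg p q hpq hq)) h1
    (Λ.r_s _).symm ?_ hpq' (le_d_compInit l x h le_rfl hq') (d_compInit _ _ _ _ _) ?_
  · rw [e0, e1]
    conv_lhs => rw [← Λ.comp_id (Λ.comp _ _ h1)]
    exact comp_congr rfl (Λ.s_comp _ _ _) _ _
  · rw [d_compInit, x.d_seg, add_assoc, add_tsub_cancel_of_le hpq]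

/-- In a locally convex `k`-graph, edges of degree `e_i` propagate along paths `l` with
`d(l)_i = 0`. -/
theorem _root_.KGraph.LocallyConvex.hasEdge (hΛ : Λ.LocallyConvex) (i : Fin k) :
    ∀ (N : ℕ) (l : Λ.Path), ∑ j, Λ.d l j = N → Λ.d l i = 0 → Λ.HasEdge (Λ.r l) i →
      Λ.HasEdge (Λ.s l) i := by
  intro N
  induction N with
  | zero =>
    intro l hN hi hr
    have hd : Λ.d l = 0 := by
      funext j
      exact (Finset.sum_eq_zero_iff.mp hN) j (Finset.mem_univ j)
    rwa [Λ.s_eq_self hd, ← Λ.r_eq_self hd]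
  | succ N ih =>
    intro l hN hi hr
    have hex : ∃ j, Λ.d l j ≠ 0 := by
      by_contra hc
      push Not at hc
      simp [hc] at hN
    obtain ⟨j, hj⟩ := hex
    have hij : i ≠ j := by rintro rfl; exact hj hi
    have hle : Pi.single j 1 ≤ Λ.d l := by
      intro a
      by_cases ha : a = j
      · subst ha; simp; omega
      · simp [ha]
    have hc := Λ.head_comp_tail l (Pi.single j 1) hle
    have hr1 : Λ.r (Λ.head l _ hle) = Λ.r l := by
      conv_rhs => rw [← hc, Λ.r_comp]
    have hs1 : Λ.s (Λ.tail l _ hle) = Λ.s l := by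
      conv_rhs => rw [← hc, Λ.s_comp]
    obtain ⟨a, ha, had⟩ := hr
    have h1 := (hΛ (Λ.r l) (Λ.d_r l) i j hij a (Λ.head l _ hle) ha had hr1 (Λ.d_head _ _ _)).2
    rw [Λ.s_head] at h1
    rw [← hs1]
    refine ih _ ?_ ?_ h1
    · have h2 : ∑ a, Λ.d l a = ∑ a, (Pi.single j 1 : Fin k → ℕ) a + ∑ a, Λ.d (Λ.tail l _ hle) a := by
        rw [← Finset.sum_add_distrib]
        refine Finset.sum_congr rfl fun a _ => ?_
        rw [Λ.d_tail]
        exact (Nat.add_sub_of_le (hle a)).symm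
      simp at h2
      omega
    · rw [Λ.d_tail]
      simp [hi]

theorem IsBoundary.shift {x : Λ.ExtPath} (hx : x.IsBoundary) (n : Fin k → ℕ)
    (hn : toENat n ≤ x.deg) : (x.shift n hn).IsBoundary := by
  intro p hp i hi
  refine hx (p + n) (add_le_deg hn hp) i ?_
  have h1 := hn i
  change (p i : ℕ∞) = x.deg i - (n i : ℕ∞) at hi
  simp only [Pi.add_apply, Nat.cast_add, hi]
  exact tsub_add_cancel_of_le h1

theorem IsBoundary.concat (hΛ : Λ.LocallyConvex) {x : Λ.ExtPath} (hx : x.IsBoundary)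
    (l : Λ.Path) (h : Λ.s l = x.range) : (concat l x h).IsBoundary := by
  intro p hp i hi hE
  have hpd : toENat (p - Λ.d l) ≤ x.deg := sub_le_deg hp
  have hle : p ≤ Λ.d l + (p - Λ.d l) := le_add_tsub
  have hi' : (p i : ℕ∞) = (Λ.d l i : ℕ∞) + x.deg i := hi
  have hdi : Λ.d l i ≤ p i := by
    have : (Λ.d l i : ℕ∞) ≤ p i := by rw [hi']; exact le_self_add
    exact_mod_cast this
  have hq' : toENat (Λ.d l + (p - Λ.d l)) ≤ (ExtPath.concat l x h).deg := fun a => by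
    change ((Λ.d l a + (p a - Λ.d l a) : ℕ) : ℕ∞) ≤ (Λ.d l a : ℕ∞) + x.deg a
    push_cast
    have := hpd a
    simp only [toENat, Pi.sub_apply, ENat.natCast_sub] at this
    gcongr
  have h1 := hΛ.hasEdge i _ ((ExtPath.concat l x h).seg p _ hle hq') rfl (by
    rw [ExtPath.d_seg]; simp only [Pi.sub_apply, Pi.add_apply]; omega) (by
    rw [ExtPath.r_seg]; exact hE)
  rw [ExtPath.s_seg, concat_seg_right l x h le_rfl hpd] at h1
  refine hx _ hpd i ?_ h1
  simp only [Pi.sub_apply, ENat.natCast_sub, hi']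
  exact (ENat.addLECancellable_of_ne_top (ENat.natCast_ne_top _)).add_tsub_cancel_left

end ExtPath

/-! ### Periodicity -/

/-- The relation `μ ∼_Λ ν`: `s(μ) = s(ν)` and `μ x = ν x` for all boundary paths
`x ∈ s(μ)Λ^{≤ ∞}`. -/
def PathEquiv (Λ : KGraph.{u} k) (μ ν : Λ.Path) : Prop :=
  ∃ h : Λ.s μ = Λ.s ν, ∀ (x : Λ.ExtPath) (_ : x.IsBoundary) (hx : Λ.s μ = x.range),
    ExtPath.concat μ x hx = ExtPath.concat ν x (h.symm.trans hx)

/-- `Per(Λ) ⊆ ℤ^k`. -/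
def Per (Λ : KGraph.{u} k) : Set (Fin k → ℤ) :=
  {z | ∃ μ ν : Λ.Path, Λ.PathEquiv μ ν ∧ z = fun i => (Λ.d μ i : ℤ) - (Λ.d ν i : ℤ)}

/-! ### The desourcification -/

/-- The coordinatewise minimum `n ∧ D` of `n ∈ ℕ^k` and `D ∈ (ℕ ∪ {∞})^k`. -/
noncomputable def inf (n : Fin k → ℕ) (D : Fin k → ℕ∞) : Fin k → ℕ := fun i => (min (n i : ℕ∞) (D i)).toNat

theorem toENat_inf (n : Fin k → ℕ) (D : Fin k → ℕ∞) (i : Fin k) :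
    toENat (inf n D) i = min (n i : ℕ∞) (D i) :=
  ENat.natCast_toNat (ne_top_of_le_ne_top (ENat.natCast_ne_top (n i)) (min_le_left _ _))

theorem inf_le_right (n : Fin k → ℕ) (D : Fin k → ℕ∞) : toENat (inf n D) ≤ D := fun i => by
  rw [toENat_inf]; exact min_le_right _ _

theorem inf_top (n : Fin k → ℕ) {D : Fin k → ℕ∞} {i : Fin k} (h : D i = ⊤) :
    inf n D i = n i := by simp [inf, h]

theorem inf_coe (n : Fin k → ℕ) {D : Fin k → ℕ∞} {i : Fin k} {d : ℕ} (h : D i = d) :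
    inf n D i = min (n i) d := by
  simp only [inf, h]
  rcases le_total (n i) d with hh | hh
  · rw [min_eq_left hh, min_eq_left (Nat.cast_le.mpr hh), ENat.toNat_natCast]
  · rw [min_eq_right hh, min_eq_right (Nat.cast_le.mpr hh), ENat.toNat_natCast]

theorem le_apply {m n : Fin k → ℕ} (h : m ≤ n) (i : Fin k) : m i ≤ n i := h i

theorem inf_mono {m n : Fin k → ℕ} (h : m ≤ n) (D : Fin k → ℕ∞) : inf m D ≤ inf n D := fun i => by
  have := le_apply h i
  change inf m D i ≤ inf n D i
  cases hD : D i with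
  | top => rwa [inf_top _ hD, inf_top _ hD]
  | coe d => rw [inf_coe _ hD, inf_coe _ hD]; omega

/-- The set `P_Λ` of all `(x; (m, n))` with `x` a boundary path and `m ≤ n` in `ℕ^k`. -/
structure PrePath (Λ : KGraph.{u} k) where
  x : Λ.ExtPath
  boundary : x.IsBoundary
  m : Fin k → ℕ
  n : Fin k → ℕ
  le : m ≤ n

namespace PrePath

variable {Λ : KGraph.{u} k}

/-- The path `x(m ∧ d(x), n ∧ d(x))` of `Λ`. -/
noncomputable def core (a : Λ.PrePath) : Λ.Path :=
  a.x.seg (inf a.m a.x.deg) (inf a.n a.x.deg) (inf_mono a.le _) (inf_le_right _ _)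

/-- `(x; (m, n)) ≈ (y; (p, q))` if and only if
(P1) `x(m ∧ d(x), n ∧ d(x)) = y(p ∧ d(y), q ∧ d(y))`,
(P2) `m - m ∧ d(x) = p - p ∧ d(y)`, and
(P3) `n - m = q - p`. -/
def Rel (a b : Λ.PrePath) : Prop :=
  a.core = b.core ∧ a.m - inf a.m a.x.deg = b.m - inf b.m b.x.deg ∧ a.n - a.m = b.n - b.m

instance setoid (Λ : KGraph.{u} k) : Setoid Λ.PrePath where
  r := Rel
  iseqv := ⟨fun _ => ⟨rfl, rfl, rfl⟩, fun h => ⟨h.1.symm, h.2.1.symm, h.2.2.symm⟩,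
    fun h h' => ⟨h.1.trans h'.1, h.2.1.trans h'.2.1, h.2.2.trans h'.2.2⟩⟩

/-- `(x; (m, m))`. -/
def rangeRep (a : Λ.PrePath) : Λ.PrePath := ⟨a.x, a.boundary, a.m, a.m, le_rfl⟩

/-- `(x; (n, n))`. -/
def sourceRep (a : Λ.PrePath) : Λ.PrePath := ⟨a.x, a.boundary, a.n, a.n, le_rfl⟩

theorem d_core (a : Λ.PrePath) : Λ.d a.core = inf a.n a.x.deg - inf a.m a.x.deg :=
  a.x.d_seg _ _ _ _

theorem core_rangeRep (a : Λ.PrePath) : a.rangeRep.core = Λ.r a.core :=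
  (a.x.r_seg _ _ _ _).symm

theorem core_sourceRep (a : Λ.PrePath) : a.sourceRep.core = Λ.s a.core :=
  (a.x.s_seg _ _ _ _).symm

theorem inf_le (n : Fin k → ℕ) (D : Fin k → ℕ∞) : inf n D ≤ n := fun i => by
  change inf n D i ≤ n i
  cases hD : D i with
  | top => rw [inf_top _ hD]
  | coe d => rw [inf_coe _ hD]; omega

theorem offset_sourceRep (a : Λ.PrePath) : a.n - inf a.n a.x.deg =
    (a.m - inf a.m a.x.deg) + (a.n - a.m) - Λ.d a.core := by
  funext i
  rw [d_core]
  have h1 := le_apply a.le i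
  have h2 := le_apply (inf_mono a.le a.x.deg) i
  have h3 := le_apply (inf_le a.n a.x.deg) i
  have h4 := le_apply (inf_le a.m a.x.deg) i
  simp only [Pi.sub_apply, Pi.add_apply]
  omega

theorem Rel.rangeRep {a b : Λ.PrePath} (h : Rel a b) : Rel a.rangeRep b.rangeRep := by
  refine ⟨?_, h.2.1, ?_⟩
  · rw [core_rangeRep, core_rangeRep, h.1]
  · simp [PrePath.rangeRep]

theorem Rel.sourceRep {a b : Λ.PrePath} (h : Rel a b) : Rel a.sourceRep b.sourceRep := by
  refine ⟨?_, ?_, ?_⟩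
  · rw [core_sourceRep, core_sourceRep, h.1]
  · change a.n - inf a.n a.x.deg = b.n - inf b.n b.x.deg
    rw [offset_sourceRep, offset_sourceRep, h.1, h.2.1, h.2.2]
  · simp [PrePath.sourceRep]

/-- If `[x; n] = [y; p]`, then `x(n ∧ d(x)) = y(p ∧ d(y))`, so that the boundary path
`x(0, n ∧ d(x)) σ^{p ∧ d(y)}(y)` makes sense. -/
theorem comp_aux {a b : Λ.PrePath} (h : Rel a.sourceRep b.rangeRep) :
    Λ.s (a.x.seg 0 (inf a.n a.x.deg) (ExtPath.zero_le' _) (inf_le_right _ _)) =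
      (b.x.shift (inf b.m b.x.deg) (inf_le_right _ _)).range := by
  rw [ExtPath.range_shift, a.x.s_seg]
  exact h.1

/-- The representative `(x(0, n ∧ d(x)) σ^{p ∧ d(y)}(y); (m, n + q - p))` of the composition of
`[x; (m, n)]` and `[y; (p, q)]`. -/
noncomputable def comp (hΛ : Λ.LocallyConvex) (a b : Λ.PrePath)
    (h : Rel a.sourceRep b.rangeRep) : Λ.PrePath where
  x := ExtPath.concat (a.x.seg 0 (inf a.n a.x.deg) (ExtPath.zero_le' _) (inf_le_right _ _))
    (b.x.shift (inf b.m b.x.deg) (inf_le_right _ _)) (comp_aux h)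
  boundary := (b.boundary.shift _ _).concat hΛ _ _
  m := a.m
  n := a.n + (b.n - b.m)
  le := a.le.trans le_self_add

section comp

variable (hΛ : Λ.LocallyConvex) (a b : Λ.PrePath) (h : Rel a.sourceRep b.rangeRep)

theorem comp_deg : (comp hΛ a b h).x.deg =
    toENat (inf a.n a.x.deg) + (b.x.deg - toENat (inf b.m b.x.deg)) := by
  change toENat (Λ.d _) + _ = _
  rw [a.x.d_seg, tsub_zero]
  rfl

theorem comp_inf_left (m : Fin k → ℕ) (hm : m ≤ a.n) :
    inf m (comp hΛ a b h).x.deg = inf m a.x.deg := by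
  funext i
  have h1 : (comp hΛ a b h).x.deg i =
      (inf a.n a.x.deg i : ℕ∞) + (b.x.deg i - (inf b.m b.x.deg i : ℕ∞)) := by
    rw [comp_deg]; rfl
  have h2 : a.n i - inf a.n a.x.deg i = b.m i - inf b.m b.x.deg i := congrFun h.2.1 i
  have h3 := le_apply hm i
  have h4 := le_apply (inf_le a.n a.x.deg) i
  cases hy : b.x.deg i with
  | top =>
    have hz : (comp hΛ a b h).x.deg i = ⊤ := by rw [h1, hy]; simp
    rw [inf_top _ hz]
    rw [inf_top _ hy] at h2
    cases hx : a.x.deg i with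
    | top => rw [inf_top _ hx]
    | coe e => rw [inf_coe _ hx]; rw [inf_coe _ hx] at h2; omega
  | coe d =>
    have hz : (comp hΛ a b h).x.deg i =
        ((inf a.n a.x.deg i + (d - inf b.m b.x.deg i) : ℕ) : ℕ∞) := by
      rw [h1, hy]; push_cast; rfl
    rw [inf_coe _ hz]
    rw [inf_coe _ hy] at h2 ⊢
    cases hx : a.x.deg i with
    | top => rw [inf_top _ hx] at *; rw [inf_top _ hx]; omega
    | coe e => rw [inf_coe _ hx] at *; rw [inf_coe _ hx]; omega

theorem comp_inf_right : inf (a.n + (b.n - b.m)) (comp hΛ a b h).x.deg =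
    inf a.n a.x.deg + (inf b.n b.x.deg - inf b.m b.x.deg) := by
  funext i
  have h1 : (comp hΛ a b h).x.deg i =
      (inf a.n a.x.deg i : ℕ∞) + (b.x.deg i - (inf b.m b.x.deg i : ℕ∞)) := by
    rw [comp_deg]; rfl
  have h2 : a.n i - inf a.n a.x.deg i = b.m i - inf b.m b.x.deg i := congrFun h.2.1 i
  have h4 := le_apply (inf_le a.n a.x.deg) i
  have h5 := le_apply b.le i
  simp only [Pi.add_apply, Pi.sub_apply]
  cases hy : b.x.deg i with
  | top =>
    have hz : (comp hΛ a b h).x.deg i = ⊤ := by rw [h1, hy]; simp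
    rw [inf_top _ hz]
    rw [inf_top _ hy] at *
    rw [inf_top _ hy]
    simp only [Pi.add_apply, Pi.sub_apply]
    omega
  | coe d =>
    have hz : (comp hΛ a b h).x.deg i =
        ((inf a.n a.x.deg i + (d - inf b.m b.x.deg i) : ℕ) : ℕ∞) := by
      rw [h1, hy]; push_cast; rfl
    rw [inf_coe _ hz]
    rw [inf_coe _ hy] at *
    rw [inf_coe _ hy]
    simp only [Pi.add_apply, Pi.sub_apply]
    omega

theorem core_comp_aux {a b : Λ.PrePath} (h : Rel a.sourceRep b.rangeRep) :
    Λ.s a.core = Λ.r b.core := by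
  rw [← core_sourceRep, ← core_rangeRep]; exact h.1

theorem core_comp : (comp hΛ a b h).core =
    Λ.comp a.core b.core (core_comp_aux h) := by
  have hz := (comp hΛ a b h).x
  have e1 : inf a.m (comp hΛ a b h).x.deg = inf a.m a.x.deg := comp_inf_left hΛ a b h a.m a.le
  have e2 : inf a.n (comp hΛ a b h).x.deg = inf a.n a.x.deg := comp_inf_left hΛ a b h a.n le_rfl
  have e3 := comp_inf_right hΛ a b h
  have hl : a.n ≤ a.n + (b.n - b.m) := le_self_add
  have hc := (comp hΛ a b h).x.seg_comp (inf a.m (comp hΛ a b h).x.deg)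
    (inf a.n (comp hΛ a b h).x.deg) (inf (a.n + (b.n - b.m)) (comp hΛ a b h).x.deg)
    (inf_mono a.le _) (inf_mono hl _) (inf_le_right _ _)
  refine hc.symm.trans (comp_congr ?_ ?_ _ _)
  · have hd : inf a.n a.x.deg ≤ Λ.d (a.x.seg 0 (inf a.n a.x.deg) (ExtPath.zero_le' _)
        (inf_le_right _ _)) := by rw [a.x.d_seg, tsub_zero]
    have hq : toENat (inf a.n a.x.deg) ≤ (comp hΛ a b h).x.deg := by
      rw [← e2]; exact inf_le_right _ _
    refine ((comp hΛ a b h).x.seg_congr e1 e2 _ _ (inf_mono a.le _) hq).trans ?_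
    refine (ExtPath.concat_seg_left _ _ (comp_aux h) (inf_mono a.le _) hd hq).trans ?_
    exact a.x.segment_seg _ _ _ _ _ le_rfl _
  · have hd : Λ.d (a.x.seg 0 (inf a.n a.x.deg) (ExtPath.zero_le' _)
        (inf_le_right _ _)) = inf a.n a.x.deg := by rw [a.x.d_seg, tsub_zero]
    have hb := inf_mono b.le b.x.deg
    have hq : toENat (inf b.n b.x.deg - inf b.m b.x.deg) ≤
        (b.x.shift (inf b.m b.x.deg) (inf_le_right _ _)).deg := fun i => by
      change ((inf b.n b.x.deg i - inf b.m b.x.deg i : ℕ) : ℕ∞) ≤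
        b.x.deg i - (inf b.m b.x.deg i : ℕ∞)
      push_cast
      exact tsub_le_tsub_right (inf_le_right b.n b.x.deg i) _
    have key := ExtPath.concat_seg_right _ _ (comp_aux h)
      (ExtPath.zero_le' (inf b.n b.x.deg - inf b.m b.x.deg)) hq
      (by rw [add_zero]; exact le_self_add)
      (by
        rw [hd, ← e3]
        exact inf_le_right _ (comp hΛ a b h).x.deg)
    refine Eq.trans ?_ (key.trans ?_)
    · exact (comp hΛ a b h).x.seg_congr (by rw [e2, hd, add_zero]) (by rw [e3, hd]) _ _ _ _
    · exact b.x.seg_congr (zero_add _) (tsub_add_cancel_of_le hb) _ _ _ _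

theorem offset_comp : (comp hΛ a b h).m - inf (comp hΛ a b h).m (comp hΛ a b h).x.deg =
    a.m - inf a.m a.x.deg := by
  change a.m - inf a.m (comp hΛ a b h).x.deg = _
  rw [comp_inf_left hΛ a b h a.m a.le]

theorem d_comp : (comp hΛ a b h).n - (comp hΛ a b h).m = (a.n - a.m) + (b.n - b.m) := by
  change a.n + (b.n - b.m) - a.m = _
  exact tsub_add_eq_add_tsub a.le |>.symm

end comp

end PrePath

/-- The set `P_Λ / ≈`. -/
def DPath (Λ : KGraph.{u} k) : Type u := Quotient (PrePath.setoid Λ)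

namespace DPath

variable {Λ : KGraph.{u} k}

/-- The class `[x; (m, n)]`. -/
def mk (a : Λ.PrePath) : Λ.DPath := Quotient.mk _ a

theorem mk_eq {a b : Λ.PrePath} : mk a = mk b ↔ PrePath.Rel a b :=
  ⟨fun h => Quotient.exact h, fun h => Quotient.sound h⟩

theorem ind' {p : Λ.DPath → Prop} (h : ∀ a, p (mk a)) (α : Λ.DPath) : p α := Quotient.ind h α

/-- `r [x; (m, n)] = [x; (m, m)]`. -/
def r : Λ.DPath → Λ.DPath :=
  Quotient.lift (fun a => mk a.rangeRep) fun _ _ h => mk_eq.mpr (PrePath.Rel.rangeRep h)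

/-- `s [x; (m, n)] = [x; (n, n)]`. -/
def s : Λ.DPath → Λ.DPath :=
  Quotient.lift (fun a => mk a.sourceRep) fun _ _ h => mk_eq.mpr (PrePath.Rel.sourceRep h)

/-- `d [x; (m, n)] = n - m`. -/
def d : Λ.DPath → (Fin k → ℕ) := Quotient.lift (fun a => a.n - a.m) fun _ _ h => h.2.2

/-- The path `x(m ∧ d(x), n ∧ d(x))` of `Λ`, for `[x; (m, n)]`. -/
noncomputable def core : Λ.DPath → Λ.Path := Quotient.lift PrePath.core fun _ _ h => h.1

/-- `m - m ∧ d(x)`, for `[x; (m, n)]`. -/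
noncomputable def offset : Λ.DPath → (Fin k → ℕ) :=
  Quotient.lift (fun a => a.m - inf a.m a.x.deg) fun _ _ h => h.2.1

theorem ext' {α β : Λ.DPath} (h₁ : α.core = β.core) (h₂ : α.offset = β.offset)
    (h₃ : α.d = β.d) : α = β := by
  induction α using ind' with | h a => ?_
  induction β using ind' with | h b => ?_
  exact mk_eq.mpr ⟨h₁, h₂, h₃⟩

theorem mk_out (α : Λ.DPath) : mk (Quotient.out α) = α := Quotient.out_eq α

theorem comp_aux {α β : Λ.DPath} (h : α.s = β.r) :
    PrePath.Rel (Quotient.out α).sourceRep (Quotient.out β).rangeRep := by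
  rw [← mk_eq]
  change (mk (Quotient.out α)).s = (mk (Quotient.out β)).r
  rw [mk_out, mk_out, h]

/-- The composition
`[x; (m, n)] ∘ [y; (p, q)] = [x(0, n ∧ d(x)) σ^{p ∧ d(y)}(y); (m, n + q - p)]`,
defined if `[x; (n, n)] = [y; (p, p)]`; the formula holds for any representatives by `comp_mk`. -/
noncomputable def comp (hΛ : Λ.LocallyConvex) (α β : Λ.DPath) (h : α.s = β.r) : Λ.DPath :=
  mk (PrePath.comp hΛ (Quotient.out α) (Quotient.out β) (comp_aux h))

theorem core_comp_aux {α β : Λ.DPath} (h : α.s = β.r) : Λ.s α.core = Λ.r β.core := by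
  have := PrePath.core_comp_aux (comp_aux h)
  change Λ.s (mk _).core = Λ.r (mk _).core at this
  rwa [mk_out, mk_out] at this

theorem core_comp (hΛ : Λ.LocallyConvex) (α β : Λ.DPath) (h : α.s = β.r) :
    (comp hΛ α β h).core = Λ.comp α.core β.core (core_comp_aux h) := by
  refine (PrePath.core_comp hΛ _ _ (comp_aux h)).trans (comp_congr ?_ ?_ _ _)
  · exact congrArg core (mk_out α)
  · exact congrArg core (mk_out β)

theorem offset_comp (hΛ : Λ.LocallyConvex) (α β : Λ.DPath) (h : α.s = β.r) :
    (comp hΛ α β h).offset = α.offset :=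
  (PrePath.offset_comp hΛ _ _ (comp_aux h)).trans (congrArg offset (mk_out α))

theorem d_comp (hΛ : Λ.LocallyConvex) (α β : Λ.DPath) (h : α.s = β.r) :
    (comp hΛ α β h).d = α.d + β.d :=
  (PrePath.d_comp hΛ _ _ (comp_aux h)).trans
    (congrArg₂ (· + ·) (congrArg d (mk_out α)) (congrArg d (mk_out β)))

/-- The composition may be computed on any representatives. -/
theorem comp_mk (hΛ : Λ.LocallyConvex) (a b : Λ.PrePath) (h : (mk a).s = (mk b).r) :
    comp hΛ (mk a) (mk b) h = mk (PrePath.comp hΛ a b (mk_eq.mp h)) := by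
  refine ext' ?_ ?_ ?_
  · rw [core_comp]; exact (PrePath.core_comp hΛ a b (mk_eq.mp h)).symm
  · rw [offset_comp]; exact (PrePath.offset_comp hΛ a b (mk_eq.mp h)).symm
  · rw [d_comp]; exact (PrePath.d_comp hΛ a b (mk_eq.mp h)).symm

theorem core_r (α : Λ.DPath) : α.r.core = Λ.r α.core := by
  induction α using ind' with | h a => exact a.core_rangeRep

theorem core_s (α : Λ.DPath) : α.s.core = Λ.s α.core := by
  induction α using ind' with | h a => exact a.core_sourceRep

theorem offset_r (α : Λ.DPath) : α.r.offset = α.offset := by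
  induction α using ind' with | h a => rfl

theorem offset_s (α : Λ.DPath) : α.s.offset = α.offset + α.d - Λ.d α.core := by
  induction α using ind' with | h a => exact a.offset_sourceRep

theorem d_r (α : Λ.DPath) : α.r.d = 0 := by
  induction α using ind' with | h a => exact tsub_self a.m

theorem d_s (α : Λ.DPath) : α.s.d = 0 := by
  induction α using ind' with | h a => exact tsub_self a.n

theorem d_core_le (α : Λ.DPath) : Λ.d α.core ≤ α.offset + α.d := by
  induction α using ind' with | h a => ?_
  intro i
  change Λ.d a.core i ≤ (a.m - inf a.m a.x.deg) i + (a.n - a.m) i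
  rw [a.d_core]
  have h1 := le_apply a.le i
  have h3 := le_apply (PrePath.inf_le a.n a.x.deg) i
  have h4 := le_apply (PrePath.inf_le a.m a.x.deg) i
  simp only [Pi.sub_apply]
  omega

/-- If `α = [z; (m, n)]` and `β = [z; (n, l)]`, then `d(core α) = d(α) ∧ d(core (α ∘ β))`. -/
theorem d_core_eq (hΛ : Λ.LocallyConvex) (α β : Λ.DPath) (h : α.s = β.r) :
    Λ.d α.core = α.d ⊓ Λ.d (comp hΛ α β h).core := by
  rw [core_comp, Λ.d_comp]
  have ho : α.s.offset = β.offset := by rw [h, offset_r]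
  induction α using ind' with | h a => ?_
  induction β using ind' with | h b => ?_
  funext i
  have h1 : a.n i - inf a.n a.x.deg i = b.m i - inf b.m b.x.deg i := congrFun ho i
  change Λ.d a.core i = min ((a.n - a.m) i) (Λ.d a.core i + Λ.d b.core i)
  rw [a.d_core, b.d_core]
  simp only [Pi.sub_apply]
  have h2 := le_apply a.le i
  have h3 := le_apply b.le i
  cases hx : a.x.deg i with
  | top => rw [inf_top _ hx] at *; rw [inf_top _ hx]; omega
  | coe e =>
    rw [inf_coe _ hx] at *
    rw [inf_coe _ hx]
    cases hy : b.x.deg i with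
    | top => rw [inf_top _ hy] at *; rw [inf_top _ hy]; omega
    | coe d => rw [inf_coe _ hy] at *; rw [inf_coe _ hy]; omega

end DPath

/-- The desourcification of a locally convex `k`-graph `Λ`: the set `P_Λ / ≈` with the range,
source, degree and composition maps defined above. -/
noncomputable def desourcification (Λ : KGraph.{u} k) (hΛ : Λ.LocallyConvex) : KGraph.{u} k where
  Path := Λ.DPath
  countable_path := by
    have := Λ.countable_path
    have : Function.Injective fun α : Λ.DPath => (α.core, α.offset, α.d) := by
      intro α β h
      simp only [Prod.mk.injEq] at h
      exact DPath.ext' h.1 h.2.1 h.2.2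
    exact this.countable
  r := DPath.r
  s := DPath.s
  r_r α := by
    induction α using DPath.ind' with | h a => rfl
  s_r α := by
    induction α using DPath.ind' with | h a => rfl
  r_s α := by
    induction α using DPath.ind' with | h a => rfl
  s_s α := by
    induction α using DPath.ind' with | h a => rfl
  comp := DPath.comp hΛ
  r_comp α β h := by
    refine DPath.ext' ?_ ?_ ?_
    · rw [DPath.core_r, DPath.core_r, DPath.core_comp, Λ.r_comp]
    · rw [DPath.offset_r, DPath.offset_r, DPath.offset_comp]
    · rw [DPath.d_r, DPath.d_r]
  s_comp α β h := by
    have ho : α.s.offset = β.offset := by rw [h, DPath.offset_r]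
    refine DPath.ext' ?_ ?_ ?_
    · rw [DPath.core_s, DPath.core_s, DPath.core_comp, Λ.s_comp]
    · rw [DPath.offset_s, DPath.offset_s, DPath.core_comp, DPath.offset_comp, DPath.d_comp,
        Λ.d_comp, ← ho, DPath.offset_s]
      funext i
      have := le_apply (DPath.d_core_le α) i
      simp only [Pi.sub_apply, Pi.add_apply] at *
      omega
    · rw [DPath.d_s, DPath.d_s]
  id_comp α := by
    refine DPath.ext' ?_ ?_ ?_
    · rw [DPath.core_comp, comp_congr (DPath.core_r α) rfl _ (Λ.s_r _), Λ.id_comp]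
    · rw [DPath.offset_comp, DPath.offset_r]
    · rw [DPath.d_comp, DPath.d_r, zero_add]
  comp_id α := by
    refine DPath.ext' ?_ ?_ ?_
    · rw [DPath.core_comp, comp_congr rfl (DPath.core_s α) _ (Λ.r_s _).symm, Λ.comp_id]
    · rw [DPath.offset_comp]
    · rw [DPath.d_comp, DPath.d_s, add_zero]
  assoc α β γ h₁ h₂ := by
    refine DPath.ext' ?_ ?_ ?_
    · refine (DPath.core_comp hΛ _ γ _).trans (Eq.trans ?_ (DPath.core_comp hΛ α _ _).symm)
      have c1 := DPath.core_comp_aux h₁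
      have c2 := DPath.core_comp_aux h₂
      refine (comp_congr (DPath.core_comp hΛ α β h₁) rfl _ ((Λ.s_comp _ _ c1).trans c2)).trans ?_
      refine (Λ.assoc _ _ _ c1 c2).trans ?_
      exact comp_congr rfl (DPath.core_comp hΛ β γ h₂).symm _ _
    · rw [DPath.offset_comp, DPath.offset_comp, DPath.offset_comp]
    · rw [DPath.d_comp, DPath.d_comp, DPath.d_comp, DPath.d_comp, add_assoc]
  d := DPath.d
  d_r := DPath.d_r
  d_s := DPath.d_s
  d_comp := DPath.d_comp hΛ
  factorization α p q hα := by
    refine existsUnique_of_exists_of_unique ?_ ?_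
    · induction α using DPath.ind' with | h a => ?_
      have hn : a.n - a.m = p + q := hα
      have hn' : a.n = a.m + p + q := by
        rw [add_assoc, ← hn, add_tsub_cancel_of_le a.le]
      let b : Λ.PrePath := ⟨a.x, a.boundary, a.m, a.m + p, le_self_add⟩
      let c : Λ.PrePath := ⟨a.x, a.boundary, a.m + p, a.n, hn' ▸ le_self_add⟩
      have hb : (DPath.mk b).d = p := add_tsub_cancel_left a.m p
      have hc : (DPath.mk c).d = q := by
        change a.n - (a.m + p) = q
        rw [hn', add_tsub_cancel_left]
      have hbc : (DPath.mk b).s = (DPath.mk c).r := rfl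
      refine ⟨(DPath.mk b, DPath.mk c), hb, hc, hbc, ?_⟩
      refine DPath.ext' ?_ ?_ ?_
      · rw [DPath.core_comp]
        exact (a.x.seg_comp _ _ _ _ _ _).symm
      · rw [DPath.offset_comp]
        rfl
      · rw [DPath.d_comp, hb, hc]
        exact hn
    · rintro ⟨β, γ⟩ ⟨β', γ'⟩ ⟨h1, h2, h, e⟩ ⟨h1', h2', h', e'⟩
      simp only at h1 h2 h e h1' h2' h' e'
      have hd : Λ.d β.core = Λ.d β'.core := by
        rw [DPath.d_core_eq hΛ β γ h, DPath.d_core_eq hΛ β' γ' h', ← e, ← e', h1, h1']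
      have hcc := e.symm.trans e'
      have hc := congrArg DPath.core hcc
      rw [DPath.core_comp, DPath.core_comp] at hc
      obtain ⟨c1, c2⟩ := comp_inj _ _ hd hc
      have ho := congrArg DPath.offset hcc
      rw [DPath.offset_comp, DPath.offset_comp] at ho
      have hβ : β = β' := DPath.ext' c1 ho (h1.trans h1'.symm)
      have hγ : γ = γ' := by
        refine DPath.ext' c2 ?_ (h2.trans h2'.symm)
        rw [← DPath.offset_r γ, ← DPath.offset_r γ', ← h, ← h', hβ]
      rw [hβ, hγ]

end KGraph

namespace KGraph

variable {k : ℕ}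

/-! An element `[x;(m,n)]` of the desourcification is determined by three data: its core `x(m ∧
d(x), n ∧ d(x))`, its offset `m - m ∧ d(x)` and its degree. An element of offset zero runs into `Λ`
from a vertex of `Λ` and leaves `Λ` in a direction `i` only where its core can no longer be
continued in that direction. Boundary paths of the desourcification have all degrees infinite.

Periods of `Λ` survive (`DPath.pathEquiv_mk_concat`). For `μ ∼ ν` and a boundary path `x` at `s(μ)`,
compare `[μx;(0,d(μ))]` and `[νx;(0,d(ν))]`. Each initial segment of a boundary path `z` at their
source is `[y;(0,q)]` with `y` a boundary path at `s(μ)`, so prolonging `z` amounts to forming `μy`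
and `νy`, which are equal.

No period is added (`DPath.pathEquiv_core`). Given `α ∼ β`, both have the same range; prepending a
common element makes both offsets zero. Testing `α ∼ β` on tails of lifts of boundary paths of `Λ`
shows that the cores are equivalent. The degree lost in passing to the core is the offset of the
source, which `α` and `β` share, so the degree difference is unchanged.

Only sums need an argument for the subgroup property. Directedness moves two equivalent pairs to a
common source, and the first part moves them to the desourcification. There `α ∼ β` says that the
shifts by `d(α)` and `d(β)` agree on all infinite paths from `s(α)`. Two such identities at one
vertex compose, and `pathEquiv_of_seg_add` turns the composite back into an equivalent pair. -/

theorem segment_self (Λ : KGraph.{u} k) (l : Λ.Path) :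
    Λ.segment l 0 (Λ.d l) (ExtPath.zero_le' _) le_rfl = l := by
  refine Λ.segment_eq (α := Λ.r l) (γ := Λ.s l) (Λ.s_r l) (Λ.r_s l).symm ?_ _ _ (Λ.d_r l) ?_
  · conv_lhs => rw [← Λ.comp_id l]
    exact comp_congr (Λ.id_comp l).symm rfl _ _
  · rw [Λ.d_r, zero_add]

/-! ### Concatenation and infinite degrees. -/

namespace ExtPath

variable {Λ : KGraph.{u} k}

/-- Segments inside an initial segment are determined by that initial segment. -/
theorem seg_eq_of_init {x y : Λ.ExtPath} {t p q : Fin k → ℕ} (hpq : p ≤ q) (hqt : q ≤ t)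
    (hx : toENat t ≤ x.deg) (hy : toENat t ≤ y.deg)
    (h : x.seg 0 t (zero_le' t) hx = y.seg 0 t (zero_le' t) hy)
    (hx' : toENat q ≤ x.deg) (hy' : toENat q ≤ y.deg) :
    x.seg p q hpq hx' = y.seg p q hpq hy' := by
  have h1 : q ≤ Λ.d (x.seg 0 t (zero_le' t) hx) := by rwa [x.d_seg, tsub_zero]
  have h2 : q ≤ Λ.d (y.seg 0 t (zero_le' t) hy) := by rwa [y.d_seg, tsub_zero]
  rw [← x.segment_seg t p q hx hpq hqt h1, ← y.segment_seg t p q hy hpq hqt h2]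
  exact Λ.segment_congr h rfl rfl _ _ _ _

theorem concat_seg_init (l : Λ.Path) (x : Λ.ExtPath) (h : Λ.s l = x.range)
    (hl : toENat (Λ.d l) ≤ (concat l x h).deg) :
    (concat l x h).seg 0 (Λ.d l) (zero_le' _) hl = l := by
  rw [concat_seg_left l x h (zero_le' _) le_rfl, segment_self]

theorem concat_seg_add (l : Λ.Path) (x : Λ.ExtPath) (h : Λ.s l = x.range) {p q : Fin k → ℕ}
    (hpq : p ≤ q) (hq : toENat q ≤ x.deg) (hpq' : p + Λ.d l ≤ q + Λ.d l)
    (hq' : toENat (q + Λ.d l) ≤ (concat l x h).deg) :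
    (concat l x h).seg (p + Λ.d l) (q + Λ.d l) hpq' hq' = x.seg p q hpq hq := by
  have hq'' : toENat (Λ.d l + q) ≤ (concat l x h).deg := by rwa [add_comm]
  rw [← concat_seg_right l x h hpq hq (by gcongr) hq'']
  exact seg_congr _ (add_comm _ _) (add_comm _ _) _ _ _ _

theorem concat_seg_zero_add (l : Λ.Path) (x : Λ.ExtPath) (h : Λ.s l = x.range) (n : Fin k → ℕ)
    (hn : toENat n ≤ x.deg) (hn' : toENat (Λ.d l + n) ≤ (concat l x h).deg) :
    (concat l x h).seg 0 (Λ.d l + n) (zero_le' _) hn' =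
      Λ.comp l (x.seg 0 n (zero_le' n) hn) (h.trans (x.r_seg _ _ _ _).symm) := by
  rw [← (concat l x h).seg_comp 0 (Λ.d l) (Λ.d l + n) (zero_le' _) le_self_add hn']
  refine comp_congr (concat_seg_init l x h _) ?_ _ _
  rw [← concat_seg_right l x h (zero_le' n) hn (by gcongr; exact zero_le' n) hn']
  exact seg_congr _ (add_zero _).symm rfl _ _ _ _

theorem range_concat (l : Λ.Path) (x : Λ.ExtPath) (h : Λ.s l = x.range) :
    (concat l x h).range = Λ.r l := by
  have := (concat l x h).r_seg 0 (Λ.d l) (zero_le' _) (d_le_concat l x h)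
  rw [concat_seg_init] at this
  exact this.symm

/-- A path with initial segment `l` followed by `x` is `l x`. -/
theorem eq_concat {l : Λ.Path} {x y : Λ.ExtPath} (h : Λ.s l = x.range)
    (hd : y.deg = toENat (Λ.d l) + x.deg)
    (hl : ∀ hn, y.seg 0 (Λ.d l) (zero_le' _) hn = l)
    (hs : ∀ p q hpq hq h₁ h₂, y.seg (p + Λ.d l) (q + Λ.d l) h₁ h₂ = x.seg p q hpq hq) :
    y = concat l x h := by
  refine ext_seg hd fun p q hpq hy hx => ?_
  have hq : toENat (q - Λ.d l) ≤ x.deg := sub_le_deg hx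
  -- The degree `d(l) + (q - d(l))` is the maximum of `d(l)` and `q`. An initial segment that long
  -- contains `l` and determines the segment from `p` to `q`.
  have ht : toENat (Λ.d l + (q - Λ.d l)) ≤ (concat l x h).deg := by
    intro i
    change ((Λ.d l i + (q i - Λ.d l i) : ℕ) : ℕ∞) ≤ (Λ.d l i : ℕ∞) + x.deg i
    rw [Nat.cast_add]
    gcongr
    exact hq i
  have ht' : toENat (Λ.d l + (q - Λ.d l)) ≤ y.deg := by rw [hd]; exact ht
  refine seg_eq_of_init hpq le_add_tsub ht' ht ?_ _ _
  rw [concat_seg_zero_add l x h _ hq ht,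
    ← y.seg_comp 0 (Λ.d l) _ (zero_le' _) le_self_add ht']
  refine comp_congr (hl _) ?_ _ _
  rw [← hs 0 (q - Λ.d l) (zero_le' _) hq (by gcongr; exact zero_le' _) (by rwa [add_comm])]
  exact seg_congr _ (zero_add _).symm (add_comm _ _) _ _ _ _

/-- Associativity lets an equivalence of finite paths be tested after composing on either side. -/
theorem concat_comp {l m : Λ.Path} (x : Λ.ExtPath) (hlm : Λ.s l = Λ.r m) (h : Λ.s m = x.range) :
    concat l (concat m x h) (hlm.trans (range_concat m x h).symm) =
      concat (Λ.comp l m hlm) x ((Λ.s_comp l m hlm).trans h) := by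
  have hadd : toENat (Λ.d l + Λ.d m) = toENat (Λ.d l) + toENat (Λ.d m) := by
    funext i; exact Nat.cast_add _ _
  refine eq_concat _ ?_ ?_ ?_
  · change toENat (Λ.d l) + (toENat (Λ.d m) + x.deg) = _
    rw [Λ.d_comp, hadd, add_assoc]
  · intro hn
    have e : Λ.d (Λ.comp l m hlm) = Λ.d l + Λ.d m := Λ.d_comp _ _ _
    have hn' := hn
    rw [e] at hn'
    rw [seg_congr _ rfl e _ hn (zero_le' _) hn',
      concat_seg_zero_add l (concat m x h) _ (Λ.d m) (d_le_concat m x h)]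
    exact comp_congr rfl (concat_seg_init _ _ _ _) _ _
  · intro p q hpq hq h₁ h₂
    have e (n) : n + Λ.d (Λ.comp l m hlm) = n + Λ.d m + Λ.d l := by
      rw [Λ.d_comp, add_assoc, add_comm (Λ.d l)]
    have hq' : toENat (q + Λ.d m) ≤ (concat m x h).deg := by
      intro i
      change ((q i + Λ.d m i : ℕ) : ℕ∞) ≤ (Λ.d m i : ℕ∞) + x.deg i
      rw [add_comm, Nat.cast_add]
      gcongr
      exact hq i
    have h₂' := h₂
    rw [e] at h₂'
    have hm : p + Λ.d m ≤ q + Λ.d m := by gcongr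
    rw [seg_congr _ (e p) (e q) h₁ h₂ (by gcongr) h₂', concat_seg_add l _ _ hm hq',
      concat_seg_add m x h hpq hq]

theorem le_deg_of_top {x : Λ.ExtPath} (hx : x.deg = ⊤) (n : Fin k → ℕ) : toENat n ≤ x.deg := by
  rw [hx]; exact le_top

theorem concat_deg_top {l : Λ.Path} {x : Λ.ExtPath} (h : Λ.s l = x.range) (hx : x.deg = ⊤) :
    (concat l x h).deg = ⊤ := by
  change toENat (Λ.d l) + x.deg = ⊤
  rw [hx]
  funext i
  change ((Λ.d l i : ℕ) : ℕ∞) + ⊤ = ⊤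
  exact add_top _

/-- The condition is vacuous: a natural number never equals `⊤`. -/
theorem isBoundary_of_top {x : Λ.ExtPath} (hx : x.deg = ⊤) : x.IsBoundary := by
  intro p _ i hi
  rw [hx] at hi
  exact absurd hi (ENat.natCast_ne_top _)

/-- If `x.deg i` were a finite `d`, the boundary condition at `p = d e_i` would forbid an edge that
exists. -/
theorem IsBoundary.deg_eq_top {x : Λ.ExtPath} (hx : x.IsBoundary)
    (hE : ∀ v ∈ Λ.vertices, ∀ i, Λ.HasEdge v i) : x.deg = ⊤ := by
  funext i
  by_contra hne
  obtain ⟨d, hd⟩ := ENat.ne_top_iff_exists.mp hne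
  have hp : toENat (Pi.single i d) ≤ x.deg := by
    intro j
    by_cases hj : j = i
    · subst hj; simp [toENat, hd]
    · simp [toENat, hj]
  refine hx _ hp i (by simpa using hd) (hE _ ?_ i)
  change Λ.d (x.seg _ _ _ _) = 0
  rw [x.d_seg, tsub_self]

theorem deg_eq_zero_of_not_hasEdge {x : Λ.ExtPath} {i : Fin k} (h : ¬ Λ.HasEdge x.range i) :
    x.deg i = 0 := by
  by_contra hne
  have hp : toENat (Pi.single i 1) ≤ x.deg := by
    intro j
    by_cases hj : j = i
    · subst hj; simpa [toENat] using Order.one_le_iff_ne_zero.mpr hne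
    · simp [toENat, hj]
  refine h ⟨x.seg 0 _ (zero_le' _) hp, x.r_seg _ _ _ _, ?_⟩
  rw [x.d_seg, tsub_zero]

end ExtPath

/-! ### Stability of path equivalence under composition. -/

theorem PathEquiv.symm {Λ : KGraph.{u} k} {μ ν : Λ.Path} (h : Λ.PathEquiv μ ν) :
    Λ.PathEquiv ν μ :=
  ⟨h.1.symm, fun x hx hr => (h.2 x hx (h.1.trans hr)).symm⟩

/-- By local convexity `γx` is again a boundary path, so the hypothesis can be applied to it. -/
theorem PathEquiv.comp_right {Λ : KGraph.{u} k} (hΛ : Λ.LocallyConvex) {μ ν γ : Λ.Path}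
    (h : Λ.PathEquiv μ ν) (hγ : Λ.s μ = Λ.r γ) :
    Λ.PathEquiv (Λ.comp μ γ hγ) (Λ.comp ν γ (h.1.symm.trans hγ)) := by
  refine ⟨by rw [Λ.s_comp, Λ.s_comp], fun x hx hr => ?_⟩
  rw [Λ.s_comp] at hr
  rw [← ExtPath.concat_comp x hγ hr, ← ExtPath.concat_comp x (h.1.symm.trans hγ) hr]
  exact h.2 _ (hx.concat hΛ γ hr) _

theorem PathEquiv.comp_left {Λ : KGraph.{u} k} {μ ν l : Λ.Path}
    (h : Λ.PathEquiv μ ν) (hμ : Λ.s l = Λ.r μ) (hν : Λ.s l = Λ.r ν) :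
    Λ.PathEquiv (Λ.comp l μ hμ) (Λ.comp l ν hν) := by
  refine ⟨by rw [Λ.s_comp, Λ.s_comp, h.1], fun x hx hr => ?_⟩
  rw [Λ.s_comp] at hr
  rw [← ExtPath.concat_comp x hμ hr, ← ExtPath.concat_comp x hν (h.1.symm.trans hr)]
  have := h.2 x hx hr
  congr 1

/-- The range can be read off `μx`. A boundary path at the source must be supplied, since otherwise
the equivalence would carry no information. -/
theorem PathEquiv.r_eq {Λ : KGraph.{u} k} {μ ν : Λ.Path} (h : Λ.PathEquiv μ ν) {x : Λ.ExtPath}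
    (hx : x.IsBoundary) (hr : Λ.s μ = x.range) : Λ.r μ = Λ.r ν := by
  rw [← ExtPath.range_concat μ x hr, h.2 x hx hr, ExtPath.range_concat]

/-! ### Existence of boundary paths. -/

/-- Only finitely many degrees are at most `(1,…,1)`. A path whose degree is maximal among them
cannot be prolonged in a direction where its degree is still `0`. -/
theorem exists_pathsLE_one (Λ : KGraph.{u} k) (l : Λ.Path) :
    ∃ m ∈ Λ.pathsLE 1, Λ.s l = Λ.r m := by
  have hfin : {n : Fin k → ℕ | n ≤ 1 ∧ ∃ m, Λ.s l = Λ.r m ∧ Λ.d m = n}.Finite :=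
    (Set.finite_Iic (1 : Fin k → ℕ)).subset fun _ h => h.1
  obtain ⟨n, ⟨hn, m, hm, rfl⟩, hmax⟩ :=
    hfin.exists_maximal ⟨0, ExtPath.zero_le' 1, Λ.s l, (Λ.r_s l).symm, Λ.d_s l⟩
  refine ⟨m, ⟨hn, fun i hi ⟨a, ha, had⟩ => ?_⟩, hm⟩
  have hd : Λ.d (Λ.comp m a ha.symm) = Λ.d m + Pi.single i 1 := by rw [Λ.d_comp, had]
  have hle : Λ.d m + Pi.single i 1 ≤ 1 := by
    intro j
    by_cases hj : j = i
    · subst hj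
      simp only [Pi.add_apply, Pi.single_eq_same, Pi.one_apply] at *
      omega
    · simpa [hj] using hn j
  have := hmax ⟨hle, _, hm.trans (Λ.r_comp m a ha.symm).symm, hd⟩ le_self_add i
  simp at this

/-- An increasing sequence of finite paths has a limit. -/
theorem ExtPath.exists_limit {Λ : KGraph.{u} k} (L : ℕ → Λ.Path)
    (hL : ∀ n, ∃ b, ∃ h : Λ.s (L n) = Λ.r b, L (n + 1) = Λ.comp (L n) b h) :
    ∃ x : Λ.ExtPath, (∀ n, toENat (Λ.d (L n)) ≤ x.deg) ∧
      (∀ q, toENat q ≤ x.deg → ∃ n, q ≤ Λ.d (L n)) ∧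
      ∀ p q hpq hq n (hn : q ≤ Λ.d (L n)), x.seg p q hpq hq = Λ.segment (L n) p q hpq hn := by
  have hmono : Monotone fun n => Λ.d (L n) := by
    refine monotone_nat_of_le_succ fun n => ?_
    obtain ⟨b, h, e⟩ := hL n
    rw [e, Λ.d_comp]
    exact le_self_add
  have hseg : ∀ p q hpq n m (hn : q ≤ Λ.d (L n)) (hm : q ≤ Λ.d (L m)), n ≤ m →
      Λ.segment (L m) p q hpq hm = Λ.segment (L n) p q hpq hn := by
    intro p q hpq n m hn hm hnm
    induction m, hnm using Nat.le_induction with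
    | base => rfl
    | succ m hnm ih =>
      obtain ⟨b, h, e⟩ := hL m
      have hq : q ≤ Λ.d (L m) := hn.trans (hmono hnm)
      rw [← ih hq, ← Λ.segment_comp (L m) b h p q hpq (by rwa [← e]) hq]
      exact Λ.segment_congr e rfl rfl _ _ _ _
  have hseg' : ∀ p q hpq n m (hn : q ≤ Λ.d (L n)) (hm : q ≤ Λ.d (L m)),
      Λ.segment (L m) p q hpq hm = Λ.segment (L n) p q hpq hn := by
    intro p q hpq n m hn hm
    rcases le_total n m with h | h
    · exact hseg _ _ _ _ _ _ _ h
    · exact (hseg _ _ _ _ _ _ _ h).symm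
  -- The degree of the limit is the coordinatewise supremum. Each coordinate of `q ≤ D` is reached
  -- at some stage; as there are finitely many coordinates and the degrees increase, one stage
  -- serves for all.
  let D : Fin k → ℕ∞ := fun i => ⨆ n, (Λ.d (L n) i : ℕ∞)
  have hD : ∀ q, toENat q ≤ D → ∃ n, q ≤ Λ.d (L n) := by
    intro q hq
    have hi : ∀ i, ∃ n, q i ≤ Λ.d (L n) i := by
      intro i
      by_contra! hc
      have h0 : 0 < q i := (Nat.zero_le _).trans_lt (hc 0)
      have h1 : D i ≤ ((q i - 1 : ℕ) : ℕ∞) :=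
        iSup_le fun n => Nat.cast_le.mpr (Nat.le_sub_one_of_lt (hc n))
      have h2 : q i ≤ q i - 1 := Nat.cast_le.mp ((hq i).trans h1)
      omega
    choose f hf using hi
    exact ⟨Finset.univ.sup f, fun i => (hf i).trans
      (hmono (Finset.le_sup (Finset.mem_univ i)) i)⟩
  choose N hN using hD
  refine ⟨⟨D, fun p q hpq hq => Λ.segment (L (N q hq)) p q hpq (hN q hq), ?_, ?_, ?_, ?_⟩,
    ?_, ?_, ?_⟩
  · intro p q hpq hq
    rw [Λ.r_segment]
    exact hseg' _ _ _ _ _ _ _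
  · intro p q hpq hq
    exact Λ.s_segment _ _ _ _ _
  · intro p q hpq hq
    exact Λ.d_segment _ _ _ _ _
  · intro p q t hpq hqt ht
    obtain ⟨h, e⟩ := Λ.segment_segment_comp (L (N t ht)) p q t hpq hqt (hN t ht)
    rw [← e]
    exact comp_congr (hseg' _ _ _ _ _ _ _) rfl _ _
  · intro n i
    exact le_iSup (fun n => (Λ.d (L n) i : ℕ∞)) n
  · exact fun q hq => ⟨N q hq, hN q hq⟩
  · intro p q hpq hq n hn
    exact hseg' _ _ _ _ _ _ _

/-- Every vertex of a locally convex `k`-graph is the range of a boundary path. -/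
theorem LocallyConvex.exists_boundary {Λ : KGraph.{u} k} (hΛ : Λ.LocallyConvex) (v : Λ.Path)
    (hv : Λ.d v = 0) : ∃ x : Λ.ExtPath, x.IsBoundary ∧ x.range = v := by
  choose step hstep hrs using Λ.exists_pathsLE_one
  -- Starting from `v`, a path of maximal degree below `(1,…,1)` is appended repeatedly; the
  -- boundary path is the limit.
  let L : ℕ → Λ.Path := fun n => Nat.rec v (fun _ l => Λ.comp l (step l) (hrs l)) n
  obtain ⟨x, hx1, hx2, hx3⟩ := ExtPath.exists_limit L fun n => ⟨step (L n), hrs (L n), rfl⟩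
  refine ⟨x, fun p hp i hi hE => ?_, ?_⟩
  · obtain ⟨n, hn⟩ := hx2 p hp
    have hmax : ∀ m, Λ.d (L m) i ≤ p i := fun m => by
      have := hx1 m i
      rw [← hi] at this
      exact Nat.cast_le.mp this
    -- From `p` onwards `L n` gains no degree in direction `i`, so local convexity carries the edge
    -- at `x(p)` to the end of `L n`. The next appended path also has `i`-degree `0`, so the edge
    -- reaches its end too, against maximality.
    have h1 : Λ.HasEdge (Λ.s (L n)) i := by
      have := hΛ.hasEdge i _ (Λ.segment (L n) p (Λ.d (L n)) hn le_rfl) rfl (by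
        rw [Λ.d_segment]; exact Nat.sub_eq_zero_of_le (hmax n)) (by
        rw [Λ.r_segment, ← hx3 p p le_rfl hp n hn]; exact hE)
      rw [← Λ.s_segment (L n) 0 _ (ExtPath.zero_le' _) le_rfl |>.trans
        (Λ.s_segment (L n) p _ hn le_rfl).symm, segment_self] at this
      exact this
    have h2 : Λ.d (step (L n)) i = 0 := by
      have h3 := hmax (n + 1)
      have h4 : Λ.d (L (n + 1)) i = Λ.d (L n) i + Λ.d (step (L n)) i :=
        congrFun (Λ.d_comp (L n) (step (L n)) (hrs (L n))) i
      have h5 := le_apply hn i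
      omega
    rw [hrs] at h1
    exact (hstep (L n)).2 i (by rw [h2]; exact Nat.one_pos) (hΛ.hasEdge i _ _ rfl h2 h1)
  · refine (hx3 0 0 le_rfl x.zero_le_deg 0 (ExtPath.zero_le' _)).trans ?_
    refine Eq.trans (Λ.segment_congr rfl rfl ?_ _ _ _ _) (Λ.segment_self v)
    exact hv.symm

/-! ### Sums of periods in a `k`-graph without sources -/

section Periods

variable {Λ : KGraph.{u} k}

/-- If `α ∼ β`, then `σ^{d(β)}(x) = σ^{d(α)}(x)` for all infinite `x` with range `s(α)`. -/
theorem PathEquiv.seg_add {α β : Λ.Path} (h : Λ.PathEquiv α β) {x : Λ.ExtPath}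
    (hx : x.deg = ⊤) (hr : x.range = Λ.s α) (p q : Fin k → ℕ) (_ : p ≤ q) (h₁ h₂ h₃ h₄) :
    x.seg (p + Λ.d α) (q + Λ.d α) h₁ h₂ = x.seg (p + Λ.d β) (q + Λ.d β) h₃ h₄ := by
  have hxb := ExtPath.isBoundary_of_top hx
  have e := h.2 x hxb hr.symm
  have hα := ExtPath.concat_deg_top hr.symm hx
  have hβ := ExtPath.concat_deg_top (h.1.symm.trans hr.symm) hx
  -- Both sides are the segment of the single path `αx = βx` starting at `p + d(α) + d(β)`: reading
  -- it after `β` gives the left side, after `α` the right side.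
  rw [← ExtPath.concat_seg_add β x (h.1.symm.trans hr.symm) h₁ h₂ (by gcongr)
      (ExtPath.le_deg_of_top hβ _),
    ← ExtPath.concat_seg_add α x hr.symm h₃ h₄ (by gcongr) (ExtPath.le_deg_of_top hα _)]
  have : ∀ (y z : Λ.ExtPath) (_ : y = z) (a b a' b' : Fin k → ℕ) (_ : a = a') (_ : b = b')
      (h₁ h₂ h₃ h₄), y.seg a b h₁ h₂ = z.seg a' b' h₃ h₄ := by
    rintro y _ rfl a b _ _ rfl rfl _ _ _ _
    rfl
  exact this _ _ e.symm _ _ _ _ (add_right_comm _ _ _) (add_right_comm _ _ _) _ _ _ _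

/-- If `σ^M(x) = σ^N(x)` for all infinite paths `x` with range `v`, then
`x(0, M + N) ∼ x(0, N + N)` for each of them. -/
theorem pathEquiv_of_seg_add (htop : ∀ x : Λ.ExtPath, x.IsBoundary → x.deg = ⊤) {v : Λ.Path}
    {M N : Fin k → ℕ}
    (H : ∀ x : Λ.ExtPath, x.deg = ⊤ → x.range = v → ∀ p q (_ : p ≤ q) h₁ h₂ h₃ h₄,
      x.seg (p + M) (q + M) h₁ h₂ = x.seg (p + N) (q + N) h₃ h₄)
    {x : Λ.ExtPath} (hx : x.deg = ⊤) (hv : x.range = v) :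
    Λ.PathEquiv (x.seg 0 (M + N) (ExtPath.zero_le' _) (ExtPath.le_deg_of_top hx _))
      (x.seg 0 (N + N) (ExtPath.zero_le' _) (ExtPath.le_deg_of_top hx _)) := by
  set μ := x.seg 0 (M + N) (ExtPath.zero_le' _) (ExtPath.le_deg_of_top hx _) with hμ
  set ν := x.seg 0 (N + N) (ExtPath.zero_le' _) (ExtPath.le_deg_of_top hx _) with hν
  have hdμ : Λ.d μ = M + N := by rw [hμ, x.d_seg, tsub_zero]
  have hdν : Λ.d ν = N + N := by rw [hν, x.d_seg, tsub_zero]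
  have hs : Λ.s μ = Λ.s ν := by
    rw [hμ, hν, x.s_seg, x.s_seg,
      ← H x hx hv N N le_rfl le_rfl (ExtPath.le_deg_of_top hx _) le_rfl
        (ExtPath.le_deg_of_top hx _)]
    exact x.seg_congr (add_comm _ _) (add_comm _ _) _ _ _ _
  refine ⟨hs, fun z hz hr => ?_⟩
  have hzt := htop z hz
  -- It must be shown that `y = μz` equals `νz`. The extra summand `N` in `d(μ) = M + N` ensures
  -- that `μ` determines both `y(0,N)` and `y(M,M+N)`.
  set y := ExtPath.concat μ z hr with hy
  have hyt : y.deg = ⊤ := ExtPath.concat_deg_top hr hzt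
  have hyv : y.range = v := by
    rw [hy, ExtPath.range_concat, hμ, x.r_seg, ← hv]; rfl
  have hY := ExtPath.le_deg_of_top hyt
  have hX := ExtPath.le_deg_of_top hx
  have hinit : y.seg 0 (M + N) (ExtPath.zero_le' _) (hY _) =
      x.seg 0 (M + N) (ExtPath.zero_le' _) (hX _) := by
    have h1 : toENat (Λ.d μ) ≤ (ExtPath.concat μ z hr).deg := hY _
    exact (y.seg_congr rfl hdμ.symm _ _ (ExtPath.zero_le' _) h1).trans
      (ExtPath.concat_seg_init μ z hr h1)
  refine ExtPath.eq_concat (hs.symm.trans hr) ?_ ?_ ?_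
  · exact hyt.trans (ExtPath.concat_deg_top (hs.symm.trans hr) hzt).symm
  · intro _
    refine (y.seg_congr rfl hdν _ _ (ExtPath.zero_le' _) (hY _)).trans ?_
    rw [hν, ← y.seg_comp 0 N (N + N) (ExtPath.zero_le' _) le_self_add (hY _),
      ← x.seg_comp 0 N (N + N) (ExtPath.zero_le' _) le_self_add (hX _)]
    refine comp_congr (ExtPath.seg_eq_of_init _ le_add_self _ _ hinit _ _) ?_ _ _
    -- The shift identity moves the second half of `ν` back inside `μ`, where `x` and `y` agree.
    have e : ∀ (w : Λ.ExtPath) (hw : w.deg = ⊤), w.range = v →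
        w.seg N (N + N) le_self_add (ExtPath.le_deg_of_top hw _) =
          w.seg M (M + N) le_self_add (ExtPath.le_deg_of_top hw _) := by
      intro w hw hwv
      have hW := ExtPath.le_deg_of_top hw
      refine Eq.trans ?_ ((H w hw hwv 0 N (ExtPath.zero_le' _)
        (by gcongr; exact ExtPath.zero_le' _) (hW _)
        (by gcongr; exact ExtPath.zero_le' _) (hW _)).symm.trans ?_)
      · exact w.seg_congr (zero_add _).symm rfl _ _ _ _
      · exact w.seg_congr (zero_add _) (add_comm _ _) _ _ _ _
    rw [e y hyt hyv, e x hx hv]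
    exact ExtPath.seg_eq_of_init _ le_rfl _ _ hinit _ _
  · intro p q hpq hq h₁ h₂
    have hle : ∀ n : Fin k → ℕ, p + n ≤ q + n := fun n => by gcongr
    -- Beyond `ν`, the shift identity replaces `N + N` by `M + N = d(μ)`, after which `y` is `z`.
    refine Eq.trans ?_ (ExtPath.concat_seg_add μ z hr hpq hq (hle _) (hY _))
    refine (y.seg_congr (p' := p + N + N) (q' := q + N + N) ?_ ?_ _ _ (by gcongr) (hY _)).trans
      ((H y hyt hyv (p + N) (q + N) (hle _) (by gcongr) (hY _) (by gcongr) (hY _)).symm.trans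
        (y.seg_congr ?_ ?_ _ _ _ _)) <;>
    simp only [hdμ, hdν, add_assoc, add_comm N M]

/-- The sum of the periods of two equivalent pairs with a common source is a period. -/
theorem Per.add_mem (htop : ∀ x : Λ.ExtPath, x.IsBoundary → x.deg = ⊤) {α β α' β' : Λ.Path}
    (h : Λ.PathEquiv α β) (h' : Λ.PathEquiv α' β') (hs : Λ.s α = Λ.s α') {x : Λ.ExtPath}
    (hx : x.deg = ⊤) (hr : x.range = Λ.s α) :
    (fun i => ((Λ.d α i : ℤ) - Λ.d β i) + ((Λ.d α' i : ℤ) - Λ.d β' i)) ∈ Λ.Per := by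
  refine ⟨_, _, pathEquiv_of_seg_add (v := Λ.s α) (M := Λ.d α + Λ.d α')
    (N := Λ.d β + Λ.d β') htop ?_ hx hr, ?_⟩
  · intro y hy hyr p q hpq h₁ h₂ h₃ h₄
    have hY := ExtPath.le_deg_of_top hy
    have hle : ∀ n : Fin k → ℕ, p + n ≤ q + n := fun n => by gcongr
    -- First `d(α)` is exchanged for `d(β)` beyond `p + d(α')`, then `d(α')` for `d(β')` beyond `p +
    -- d(β)`.
    have e1 := h.seg_add hy hyr (p + Λ.d α') (q + Λ.d α') (hle _) (by gcongr) (hY _)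
      (by gcongr) (hY _)
    have e2 := h'.seg_add hy (hyr.trans hs) (p + Λ.d β) (q + Λ.d β) (hle _) (by gcongr) (hY _)
      (by gcongr) (hY _)
    refine (y.seg_congr ?_ ?_ _ _ _ _).trans (e1.trans ((y.seg_congr ?_ ?_ _ _ _ _).trans
      (e2.trans (y.seg_congr ?_ ?_ _ _ _ _)))) <;>
    abel
  · funext i
    rw [x.d_seg, x.d_seg, tsub_zero, tsub_zero]
    simp only [Pi.add_apply]
    push_cast
    ring

end Periods

/-! ### Arithmetic of `n ∧ D`. -/

theorem inf_eq_self {n : Fin k → ℕ} {D : Fin k → ℕ∞} (h : toENat n ≤ D) : inf n D = n := by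
  funext i
  cases hD : D i with
  | top => rw [inf_top _ hD]
  | coe d =>
    have h1 : (n i : ℕ∞) ≤ D i := h i
    rw [hD] at h1
    rw [inf_coe _ hD]
    exact min_eq_left (Nat.cast_le.mp h1)

theorem inf_zero (D : Fin k → ℕ∞) : inf 0 D = 0 :=
  inf_eq_self fun i => by simp [toENat]

theorem inf_add_toENat (m n : Fin k → ℕ) (D : Fin k → ℕ∞) :
    inf (m + n) (toENat m + D) = m + inf n D := by
  funext i
  cases hD : D i with
  | top =>
    have : (toENat m + D) i = ⊤ := by simp [hD]
    rw [Pi.add_apply, inf_top _ hD, inf_top _ this]; rfl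
  | coe d =>
    have : (toENat m + D) i = ((m i + d : ℕ) : ℕ∞) := by simp [hD, toENat]
    rw [Pi.add_apply, inf_coe _ hD, inf_coe _ this, Pi.add_apply]
    omega

/-- The degree `D` is determined by the map `n ↦ n ∧ D`. -/
theorem eq_of_inf_eq {D E : Fin k → ℕ∞} (h : ∀ n, inf n D = inf n E) : D = E := by
  have key : ∀ D E : Fin k → ℕ∞, (∀ n, inf n D = inf n E) → D ≤ E := by
    intro D E h i
    refine ENat.forall_natCast_le_iff_le.mp fun a ha => ?_
    have h1 := toENat_inf (fun _ => a) D i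
    rw [h, toENat_inf, min_eq_left ha] at h1
    exact min_eq_left_iff.mp h1
  exact le_antisymm (key D E h) (key E D fun n => (h n).symm)

/-! ### Infinite paths in the desourcification. -/

namespace ExtPath

variable {Λ : KGraph.{u} k}

/-- The infinite path `(p, q) ↦ [w; (p, q)]` in the desourcification. -/
def lift (hΛ : Λ.LocallyConvex) (w : Λ.ExtPath) (hw : w.IsBoundary) :
    (Λ.desourcification hΛ).ExtPath where
  deg := ⊤
  seg p q hpq _ := DPath.mk ⟨w, hw, p, q, hpq⟩
  r_seg _ _ _ _ := rfl
  s_seg _ _ _ _ := rfl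
  d_seg _ _ _ _ := rfl
  seg_comp p q t hpq hqt ht := by
    have h : (DPath.mk ⟨w, hw, p, q, hpq⟩).s = (DPath.mk ⟨w, hw, q, t, hqt⟩).r := rfl
    refine DPath.ext' ?_ ?_ ?_
    · exact (DPath.core_comp hΛ _ _ h).trans (w.seg_comp _ _ _ (inf_mono hpq _) (inf_mono hqt _) _)
    · exact DPath.offset_comp hΛ _ _ h
    · refine (DPath.d_comp hΛ _ _ h).trans ?_
      change (q - p) + (t - q) = t - p
      rw [add_comm, tsub_add_tsub_cancel hqt hpq]

/-- The offsets `n - n ∧ d(w)` recover every `n ∧ d(w)`, hence `d(w)`; within that degree the cores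
are the segments of `w` themselves. -/
theorem lift_injective (hΛ : Λ.LocallyConvex) {w w' : Λ.ExtPath} {hw : w.IsBoundary}
    {hw' : w'.IsBoundary} (h : lift hΛ w hw = lift hΛ w' hw') : w = w' := by
  have key : ∀ p q (hpq : p ≤ q), PrePath.Rel ⟨w, hw, p, q, hpq⟩ ⟨w', hw', p, q, hpq⟩ := by
    intro p q hpq
    have : ∀ y z : (Λ.desourcification hΛ).ExtPath, y = z → ∀ h₁ h₂,
        y.seg p q hpq h₁ = z.seg p q hpq h₂ := by
      rintro y _ rfl _ _; rfl
    exact DPath.mk_eq.mp (this _ _ h le_top le_top)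
  refine ext_seg (eq_of_inf_eq fun n => ?_) fun p q hpq hx hy => ?_
  · have h1 : n - inf n w.deg = n - inf n w'.deg := (key n n le_rfl).2.1
    funext i
    have h2 : n i - inf n w.deg i = n i - inf n w'.deg i := congrFun h1 i
    have h3 := le_apply (PrePath.inf_le n w.deg) i
    have h4 := le_apply (PrePath.inf_le n w'.deg) i
    omega
  · have h1 : PrePath.core ⟨w, hw, p, q, hpq⟩ = PrePath.core ⟨w', hw', p, q, hpq⟩ :=
      (key p q hpq).1
    refine Eq.trans ?_ (h1.trans ?_)
    · exact w.seg_congr (inf_eq_self ((toENat_mono hpq).trans hx)).symm (inf_eq_self hx).symm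
        _ _ _ _
    · exact w'.seg_congr (inf_eq_self ((toENat_mono hpq).trans hy)) (inf_eq_self hy) _ _ _ _

/-- Boundary paths in the desourcification are infinite. -/
theorem IsBoundary.deg_eq_top_of_desourcification {hΛ : Λ.LocallyConvex}
    {z : (Λ.desourcification hΛ).ExtPath} (hz : z.IsBoundary) : z.deg = ⊤ := by
  refine hz.deg_eq_top fun v hv i => ?_
  have hv' := (Λ.desourcification hΛ).r_eq_self hv
  induction v using DPath.ind' with | h a => ?_
  -- Nothing bounds `n` in `[x;(m,n)]`, so the vertex `[x;(m,m)]` emits an edge in every direction.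
  refine ⟨DPath.mk ⟨a.x, a.boundary, a.m, a.m + Pi.single i 1, le_self_add⟩, ?_, ?_⟩
  · exact hv'
  · exact add_tsub_cancel_left _ _

end ExtPath

/-! ### Elements of offset zero and their cores. -/

namespace DPath

variable {Λ : KGraph.{u} k}

/-- If `[x; (m, n)]` leaves `x` in the direction `i`, then its core ends where there is no edge of
degree `e_i`. -/
theorem not_hasEdge {α : Λ.DPath} {i : Fin k} (h : α.s.offset i ≠ 0) :
    ¬ Λ.HasEdge (Λ.s α.core) i := by
  induction α using ind' with | h a => ?_
  have h' : a.n i - inf a.n a.x.deg i ≠ 0 := h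
  have := a.boundary (inf a.n a.x.deg) (inf_le_right _ _) i (by
    cases hD : a.x.deg i with
    | top => rw [inf_top _ hD] at h'; omega
    | coe d => rw [inf_coe _ hD] at h' ⊢; congr 1; omega)
  rwa [ExtPath.vertex, ← a.x.s_seg (inf a.m a.x.deg) _ (inf_mono a.le _)] at this

/-- An element of offset zero is represented by an initial segment. -/
theorem exists_eq_mk {α : Λ.DPath} (h : α.offset = 0) :
    ∃ (y : Λ.ExtPath) (hy : y.IsBoundary), y.range = Λ.r α.core ∧
      α = mk ⟨y, hy, 0, α.d, ExtPath.zero_le' _⟩ := by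
  induction α using ind' with | h a => ?_
  have h' : ∀ i, a.m i - inf a.m a.x.deg i = 0 := fun i => congrFun h i
  -- Offset zero means `m ≤ d(x)`, so `x` may be replaced by `σ^m(x)` and `m` by `0`.
  have hm : inf a.m a.x.deg = a.m := by
    funext i
    have := h' i
    have := le_apply (PrePath.inf_le a.m a.x.deg) i
    omega
  have hmd : toENat a.m ≤ a.x.deg := by rw [← hm]; exact inf_le_right _ _
  have hdeg : a.x.deg = toENat a.m + (a.x.shift a.m hmd).deg := by
    funext i
    exact (add_tsub_cancel_of_le (hmd i)).symm
  have hn : a.n = a.m + (a.n - a.m) := (add_tsub_cancel_of_le a.le).symm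
  have hnd : inf a.n a.x.deg = a.m + inf (a.n - a.m) (a.x.shift a.m hmd).deg := by
    conv_lhs => rw [hn, hdeg]
    exact inf_add_toENat _ _ _
  refine ⟨a.x.shift a.m hmd, a.boundary.shift _ _, ?_, ext' ?_ ?_ ?_⟩
  · rw [ExtPath.range_shift]
    refine Eq.trans ?_ (a.x.r_seg _ _ _ _).symm
    exact a.x.seg_congr hm.symm hm.symm _ _ _ _
  · refine a.x.seg_congr ?_ ?_ _ _ _ _
    · change inf a.m a.x.deg = inf 0 _ + a.m
      rw [inf_zero, hm, zero_add]
    · change inf a.n a.x.deg = inf (a.n - a.m) _ + a.m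
      rw [hnd, add_comm]
  · rw [h]
    exact (zero_tsub _).symm
  · exact (tsub_zero _).symm

/-- `(n + d(α)) ∧ d(core(α) w) = d(core(α)) + n ∧ d(w)`, if `α` has offset zero. -/
theorem inf_add_d {α : Λ.DPath} (h : α.offset = 0) {w : Λ.ExtPath} (hr : Λ.s α.core = w.range)
    (n : Fin k → ℕ) :
    inf (n + α.d) (ExtPath.concat α.core w hr).deg = Λ.d α.core + inf n w.deg := by
  change inf _ (toENat (Λ.d α.core) + w.deg) = _
  funext i
  have h1 : α.s.offset i = α.d i - Λ.d α.core i := by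
    rw [offset_s, h, zero_add]; rfl
  have h2 : Λ.d α.core i ≤ α.d i := by
    have := le_apply (d_core_le α) i
    rwa [h, zero_add] at this
  -- In direction `i`, either `α` and its core have the same degree, or no edge leaves the end of
  -- the core; then `d(w)_i = 0` and both sides are `d(core(α))_i`.
  by_cases h0 : α.s.offset i = 0
  · have h3 : α.d i = Λ.d α.core i := by omega
    rw [← inf_add_toENat, inf, inf, Pi.add_apply, Pi.add_apply, h3, add_comm (n i)]
    rfl
  · have hw : w.deg i = ((0 : ℕ) : ℕ∞) :=
      ExtPath.deg_eq_zero_of_not_hasEdge (by rw [← hr]; exact not_hasEdge h0)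
    have hu : (toENat (Λ.d α.core) + w.deg) i = (Λ.d α.core i : ℕ∞) := by
      rw [Pi.add_apply, hw, Nat.cast_zero, add_zero]; rfl
    rw [Pi.add_apply, inf_coe _ hw, inf_coe _ hu, Pi.add_apply]
    omega

/-- `α = [core(α) w; (0, d(α))]`, if `α` has offset zero. -/
theorem eq_mk_concat {α : Λ.DPath} (h : α.offset = 0) {w : Λ.ExtPath} (hr : Λ.s α.core = w.range)
    (hu : (ExtPath.concat α.core w hr).IsBoundary) :
    α = mk ⟨ExtPath.concat α.core w hr, hu, 0, α.d, ExtPath.zero_le' _⟩ := by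
  have e := inf_add_d h hr 0
  rw [zero_add, inf_zero, add_zero] at e
  refine ext' ?_ ?_ ?_
  · refine (ExtPath.concat_seg_init α.core w hr (ExtPath.d_le_concat _ _ _)).symm.trans ?_
    exact ExtPath.seg_congr _ (inf_zero _).symm e.symm _ _ _ _
  · rw [h]
    exact (zero_tsub _).symm
  · exact (tsub_zero _).symm

theorem core_mk_add_d {α : Λ.DPath} (h : α.offset = 0) {w : Λ.ExtPath}
    (hr : Λ.s α.core = w.range) (hu : (ExtPath.concat α.core w hr).IsBoundary) (p q : Fin k → ℕ)
    (hpq : p ≤ q) (hpq' : p + α.d ≤ q + α.d) :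
    (mk ⟨ExtPath.concat α.core w hr, hu, p + α.d, q + α.d, hpq'⟩).core =
      w.seg (inf p w.deg) (inf q w.deg) (inf_mono hpq _) (inf_le_right _ _) := by
  have hq : toENat (Λ.d α.core + inf q w.deg) ≤ (ExtPath.concat α.core w hr).deg := by
    rw [← inf_add_d h hr]; exact inf_le_right _ _
  have hle := inf_mono hpq w.deg
  refine Eq.trans ?_ (ExtPath.concat_seg_right α.core w hr hle (inf_le_right _ _)
    (by gcongr) hq)
  exact ExtPath.seg_congr _ (inf_add_d h hr p) (inf_add_d h hr q) _ _ _ _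

/-- Together with `core_mk_add_d`, this shows that the part of the lift of `core(α) w` beyond `d(α)`
depends on `α` only through the offset of `α.s`. -/
theorem offset_mk_add_d {α : Λ.DPath} (h : α.offset = 0) {w : Λ.ExtPath}
    (hr : Λ.s α.core = w.range) (hu : (ExtPath.concat α.core w hr).IsBoundary) (p q : Fin k → ℕ)
    (hpq : p + α.d ≤ q + α.d) :
    (mk ⟨ExtPath.concat α.core w hr, hu, p + α.d, q + α.d, hpq⟩).offset =
      α.s.offset + (p - inf p w.deg) := by
  change p + α.d - inf (p + α.d) _ = _
  rw [inf_add_d h hr, offset_s, h, zero_add]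
  funext i
  have h1 := le_apply (PrePath.inf_le p w.deg) i
  have h2 : Λ.d α.core i ≤ α.d i := by
    have := le_apply (d_core_le α) i
    rwa [h, zero_add] at this
  simp only [Pi.sub_apply, Pi.add_apply]
  omega

/-- Equivalent elements of offset zero in the desourcification have equivalent cores. -/
theorem pathEquiv_core {hΛ : Λ.LocallyConvex} {α β : Λ.DPath}
    (h : (Λ.desourcification hΛ).PathEquiv α β) (hα : α.offset = 0) (hβ : β.offset = 0) :
    Λ.PathEquiv α.core β.core := by
  have hs : α.s = β.s := h.1
  have hsc : Λ.s α.core = Λ.s β.core := by rw [← core_s, ← core_s, hs]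
  refine ⟨hsc, fun w hw hr => ?_⟩
  have hr' := hsc.symm.trans hr
  have hu := hw.concat hΛ α.core hr
  have hu' := hw.concat hΛ β.core hr'
  -- The test path is the tail of the lift of `core(α) w` beyond `α`, so `αz` is that lift. As `α`
  -- and `β` have a common source, the lift of `core(β) w` has the same tail and equals `βz`;
  -- injectivity of the lift concludes.
  let z := (ExtPath.lift hΛ _ hu).shift α.d le_top
  have hz : z.IsBoundary := (ExtPath.isBoundary_of_top rfl).shift _ _
  have hzt := hz.deg_eq_top_of_desourcification
  have hαz : (Λ.desourcification hΛ).s α = z.range := by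
    refine Eq.trans ?_ (ExtPath.range_shift _ _ _).symm
    conv_lhs => rw [eq_mk_concat hα hr hu]
    rfl
  have hdeg : ∀ γ : Λ.DPath, ⊤ = toENat ((Λ.desourcification hΛ).d γ) + z.deg := by
    intro γ
    rw [hzt]
    funext i
    exact (add_top ((Λ.desourcification hΛ).d γ i : ℕ∞)).symm
  have e1 : ExtPath.lift hΛ _ hu = ExtPath.concat α z hαz :=
    ExtPath.eq_concat _ (hdeg α) (fun _ => (eq_mk_concat hα hr hu).symm)
      fun p q hpq hq h₁ h₂ => rfl
  have e2 : ExtPath.lift hΛ _ hu' = ExtPath.concat β z (h.1.symm.trans hαz) := by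
    refine ExtPath.eq_concat _ (hdeg β) (fun _ => (eq_mk_concat hβ hr' hu').symm)
      fun p q hpq hq h₁ h₂ => ext' ?_ ?_ ?_
    · exact (core_mk_add_d hβ hr' hu' p q hpq h₁).trans
        (core_mk_add_d hα hr hu p q hpq (by gcongr)).symm
    · refine (offset_mk_add_d hβ hr' hu' p q h₁).trans ?_
      rw [← hs]
      exact (offset_mk_add_d hα hr hu p q (by gcongr)).symm
    · exact (add_tsub_add_eq_tsub_right q β.d p).trans (add_tsub_add_eq_tsub_right q α.d p).symm
  exact ExtPath.lift_injective hΛ (e1.trans ((h.2 z hz hαz).trans e2.symm))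

/-! ### Paths of `Λ` inside the desourcification. -/

section Embedding

variable {μ : Λ.Path} {x : Λ.ExtPath} (hr : Λ.s μ = x.range)
  (hu : (ExtPath.concat μ x hr).IsBoundary)

theorem core_mk_concat (n : Fin k → ℕ) :
    (mk ⟨ExtPath.concat μ x hr, hu, 0, Λ.d μ + n, ExtPath.zero_le' _⟩).core =
      Λ.comp μ (x.seg 0 (inf n x.deg) (ExtPath.zero_le' _) (inf_le_right _ _))
        (hr.trans (x.r_seg _ _ _ _).symm) := by
  have e : inf (Λ.d μ + n) (ExtPath.concat μ x hr).deg = Λ.d μ + inf n x.deg :=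
    inf_add_toENat _ _ _
  have hq : toENat (Λ.d μ + inf n x.deg) ≤ (ExtPath.concat μ x hr).deg := by
    rw [← e]; exact inf_le_right _ _
  rw [← ExtPath.concat_seg_zero_add μ x hr _ (inf_le_right _ _) hq]
  exact ExtPath.seg_congr _ (inf_zero _) e _ _ _ _

theorem core_mk_concat_d :
    (mk ⟨ExtPath.concat μ x hr, hu, 0, Λ.d μ, ExtPath.zero_le' _⟩).core = μ := by
  have e : inf (Λ.d μ) (ExtPath.concat μ x hr).deg = Λ.d μ :=
    inf_eq_self (ExtPath.d_le_concat _ _ _)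
  refine Eq.trans ?_ (ExtPath.concat_seg_init μ x hr (ExtPath.d_le_concat _ _ _))
  exact ExtPath.seg_congr _ (inf_zero _) e _ _ _ _

/-- `s [μ x; (0, d(μ))] = [x; (0, 0)]`. -/
theorem s_mk_concat (hx : x.IsBoundary) :
    (mk ⟨ExtPath.concat μ x hr, hu, 0, Λ.d μ, ExtPath.zero_le' _⟩).s =
      mk ⟨x, hx, 0, 0, le_rfl⟩ := by
  refine ext' ?_ ?_ ?_
  · rw [core_s, core_mk_concat_d, hr]
    exact x.seg_congr (inf_zero _).symm (inf_zero _).symm _ _ _ _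
  · change Λ.d μ - inf (Λ.d μ) (ExtPath.concat μ x hr).deg = 0 - inf 0 x.deg
    rw [inf_eq_self (ExtPath.d_le_concat _ _ _), tsub_self, zero_tsub]
  · rw [d_s]
    exact (tsub_self _).symm

/-- `[μ x; (0, d(μ))] ∘ [y; (0, n)] = [μ y; (0, d(μ) + n)]`. -/
theorem comp_mk_concat (hΛ : Λ.LocallyConvex) {y : Λ.ExtPath} (hy : y.IsBoundary)
    (hr' : Λ.s μ = y.range) (hu' : (ExtPath.concat μ y hr').IsBoundary) (n : Fin k → ℕ) (h) :
    comp hΛ (mk ⟨ExtPath.concat μ x hr, hu, 0, Λ.d μ, ExtPath.zero_le' _⟩)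
        (mk ⟨y, hy, 0, n, ExtPath.zero_le' _⟩) h =
      mk ⟨ExtPath.concat μ y hr', hu', 0, Λ.d μ + n, ExtPath.zero_le' _⟩ := by
  refine ext' ?_ ?_ ?_
  · rw [core_comp, core_mk_concat]
    refine comp_congr (core_mk_concat_d _ _) ?_ _ _
    exact y.seg_congr (inf_zero _) rfl _ _ _ _
  · rw [offset_comp]
    exact (zero_tsub _).trans (zero_tsub _).symm
  · rw [d_comp]
    change (Λ.d μ - 0) + (n - 0) = Λ.d μ + n - 0
    simp only [tsub_zero]

/-- If `z(0, n) = [y; (0, n)]`, then `[μ x; (0, d(μ))] z` and `μ y` agree up to `d(μ) + n`. -/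
theorem concat_mk_concat_seg {hΛ : Λ.LocallyConvex} {z : (Λ.desourcification hΛ).ExtPath}
    (hzt : z.deg = ⊤)
    (hz : (Λ.desourcification hΛ).s
      (mk ⟨ExtPath.concat μ x hr, hu, 0, Λ.d μ, ExtPath.zero_le' _⟩) = z.range)
    {y : Λ.ExtPath} (hy : y.IsBoundary) (hr' : Λ.s μ = y.range)
    (hu' : (ExtPath.concat μ y hr').IsBoundary) {n : Fin k → ℕ}
    (hn : ∀ h, z.seg 0 n (ExtPath.zero_le' _) h = mk ⟨y, hy, 0, n, ExtPath.zero_le' _⟩)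
    {p q : Fin k → ℕ} (hpq : p ≤ q) (hq : q ≤ n) (h') :
    (ExtPath.concat _ z hz).seg p q hpq h' =
      mk ⟨ExtPath.concat μ y hr', hu', p, q, hpq⟩ := by
  set α : (Λ.desourcification hΛ).Path :=
    mk ⟨ExtPath.concat μ x hr, hu, 0, Λ.d μ, ExtPath.zero_le' _⟩ with hα
  have hc := ExtPath.le_deg_of_top (ExtPath.concat_deg_top hz hzt)
  have hdα : (Λ.desourcification hΛ).d α = Λ.d μ := tsub_zero _
  refine ExtPath.seg_eq_of_init (y := ExtPath.lift hΛ _ hu') (t := Λ.d μ + n) hpq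
    (hq.trans le_add_self) (hc _) le_top ?_ _ le_top
  refine Eq.trans ?_ ((ExtPath.concat_seg_zero_add α z hz n (ExtPath.le_deg_of_top hzt n)
    (hc _)).trans ?_)
  · exact ExtPath.seg_congr _ rfl (by rw [hdα]) _ _ _ _
  · have h2 : α.s = (mk ⟨y, hy, 0, n, ExtPath.zero_le' _⟩).r := by
      have := z.r_seg 0 n (ExtPath.zero_le' _) (ExtPath.le_deg_of_top hzt n)
      rw [hn] at this
      exact hz.trans this.symm
    have h3 : (Λ.desourcification hΛ).s α =
        (Λ.desourcification hΛ).r (mk ⟨y, hy, 0, n, ExtPath.zero_le' _⟩) := h2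
    exact (comp_congr rfl (hn _) _ h3).trans (comp_mk_concat hr hu hΛ hy hr' hu' n h2)

end Embedding

/-- If `μ ∼ ν` in `Λ`, then `[μ x; (0, d(μ))] ∼ [ν x; (0, d(ν))]` in the desourcification. -/
theorem pathEquiv_mk_concat {hΛ : Λ.LocallyConvex} {μ ν : Λ.Path} (h : Λ.PathEquiv μ ν)
    {x : Λ.ExtPath} (hx : x.IsBoundary) (hμ : Λ.s μ = x.range) (hν : Λ.s ν = x.range) :
    (Λ.desourcification hΛ).PathEquiv
      (mk ⟨ExtPath.concat μ x hμ, hx.concat hΛ μ hμ, 0, Λ.d μ, ExtPath.zero_le' _⟩)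
      (mk ⟨ExtPath.concat ν x hν, hx.concat hΛ ν hν, 0, Λ.d ν, ExtPath.zero_le' _⟩) := by
  have hsμ := s_mk_concat hμ (hx.concat hΛ μ hμ) hx
  have hsν := s_mk_concat hν (hx.concat hΛ ν hν) hx
  refine ⟨hsμ.trans hsν.symm, fun z hz hr => ?_⟩
  have hzt := hz.deg_eq_top_of_desourcification
  have hr' := (hsν.trans hsμ.symm).trans hr
  refine ExtPath.ext_seg ?_ fun p q hpq h₁ h₂ => ?_
  · exact (ExtPath.concat_deg_top hr hzt).trans (ExtPath.concat_deg_top hr' hzt).symm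
  -- It suffices to treat each `q` separately. The segment `z(0,q)` starts at `[x;(0,0)]`, so it has
  -- offset zero and equals `[y;(0,q)]` for some `y`, chosen for this `q`, that begins at `x(0)`.
  · set ζ : Λ.DPath := z.seg 0 q (ExtPath.zero_le' _) (ExtPath.le_deg_of_top hzt q) with hζ
    have hrζ : ζ.r = mk ⟨x, hx, 0, 0, le_rfl⟩ :=
      (z.r_seg 0 q (ExtPath.zero_le' _) (ExtPath.le_deg_of_top hzt q)).trans (hr.symm.trans hsμ)
    have hdζ : ζ.d = q := (z.d_seg _ _ _ _).trans (tsub_zero _)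
    have hoζ : ζ.offset = 0 := by
      rw [← offset_r, hrζ]
      exact zero_tsub _
    obtain ⟨y, hy, hyr, e⟩ := exists_eq_mk hoζ
    have hyx : y.range = x.range := by
      rw [hyr, ← core_r, hrζ]
      exact x.seg_congr (inf_zero _) (inf_zero _) _ _ _ _
    have hn : ∀ h, z.seg 0 q (ExtPath.zero_le' _) h = mk ⟨y, hy, 0, q, ExtPath.zero_le' _⟩ := by
      intro _
      refine e.trans (mk_eq.mpr ?_)
      rw [hdζ]
      exact ⟨rfl, rfl, rfl⟩
    have hyμ := hμ.trans hyx.symm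
    have hyν := hν.trans hyx.symm
    have huμ := hy.concat hΛ μ hyμ
    have huν := hy.concat hΛ ν hyν
    refine (concat_mk_concat_seg hμ (hx.concat hΛ μ hμ) hzt hr hy hyμ huμ hn hpq le_rfl h₁).trans
      (Eq.trans ?_ (concat_mk_concat_seg hν (hx.concat hΛ ν hν) hzt hr' hy hyν huν hn hpq le_rfl
        h₂).symm)
    have : ∀ (u v : Λ.ExtPath) (hu : u.IsBoundary) (hv : v.IsBoundary), u = v →
        mk ⟨u, hu, p, q, hpq⟩ = mk ⟨v, hv, p, q, hpq⟩ := by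
      rintro u _ _ _ rfl; rfl
    exact this _ _ _ _ (h.2 y hy hyμ)

end DPath

/-! ### The two inclusions and the group structure. -/

theorem Per_subset_desourcification (Λ : KGraph.{u} k) (hΛ : Λ.LocallyConvex) :
    Λ.Per ⊆ (Λ.desourcification hΛ).Per := by
  rintro _ ⟨μ, ν, h, rfl⟩
  obtain ⟨x, hx, hr⟩ := hΛ.exists_boundary (Λ.s μ) (Λ.d_s μ)
  exact ⟨_, _, DPath.pathEquiv_mk_concat h hx hr.symm (h.1.symm.trans hr.symm), rfl⟩

theorem desourcification_Per_subset (Λ : KGraph.{u} k) (hΛ : Λ.LocallyConvex) :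
    (Λ.desourcification hΛ).Per ⊆ Λ.Per := by
  have main : ∀ α β : Λ.DPath, (Λ.desourcification hΛ).PathEquiv α β → α.offset = 0 →
      β.offset = 0 → (fun i => (α.d i : ℤ) - (β.d i : ℤ)) ∈ Λ.Per := by
    intro α β h hα hβ
    refine ⟨_, _, DPath.pathEquiv_core h hα hβ, ?_⟩
    funext i
    have hs : α.s = β.s := h.1
    -- At offset zero, `d(α) - d(core(α))` is the offset of `α.s`, hence the same for `β`; the
    -- truncated subtraction is exact by `h2` and `h3`.
    have h1 := congrFun (congrArg DPath.offset hs) i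
    have h2 := le_apply (DPath.d_core_le α) i
    have h3 := le_apply (DPath.d_core_le β) i
    rw [DPath.offset_s, DPath.offset_s, hα, hβ, zero_add, zero_add] at h1
    rw [hα, zero_add] at h2
    rw [hβ, zero_add] at h3
    simp only [Pi.sub_apply] at h1
    omega
  rintro _ ⟨α, β, h, rfl⟩
  have hrr : (Λ.desourcification hΛ).r α = (Λ.desourcification hΛ).r β := by
    induction α using DPath.ind' with | h a => ?_
    refine h.r_eq (x := (ExtPath.lift hΛ a.x a.boundary).shift a.n le_top)
      ((ExtPath.isBoundary_of_top rfl).shift _ _) ?_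
    exact (ExtPath.range_shift (ExtPath.lift hΛ a.x a.boundary) a.n le_top).symm
  -- For `α = [x;(m,n)]` take `l = [x;(0,m)]`. Composition keeps the offset of its first factor, so
  -- `lα` and `lβ` both have offset zero, while the degree difference is unaltered.
  obtain ⟨l, hl, hlo⟩ : ∃ l : (Λ.desourcification hΛ).Path,
      (Λ.desourcification hΛ).s l = (Λ.desourcification hΛ).r α ∧ DPath.offset l = 0 := by
    clear hrr h
    induction α using DPath.ind' with | h a => ?_
    exact ⟨DPath.mk ⟨a.x, a.boundary, 0, a.m, ExtPath.zero_le' _⟩, rfl, zero_tsub _⟩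
  have hl' := hl.trans hrr
  have := main _ _ (h.comp_left hl hl') ((DPath.offset_comp hΛ l α hl).trans hlo)
    ((DPath.offset_comp hΛ l β hl').trans hlo)
  convert this using 2 with i
  have e1 : (DPath.comp hΛ l α hl).d = DPath.d l + DPath.d α := DPath.d_comp hΛ l α hl
  have e2 : (DPath.comp hΛ l β hl').d = DPath.d l + DPath.d β := DPath.d_comp hΛ l β hl'
  change (DPath.d α i : ℤ) - DPath.d β i =
    ((DPath.comp hΛ l α hl).d i : ℤ) - (DPath.comp hΛ l β hl').d i
  rw [e1, e2, Pi.add_apply, Pi.add_apply]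
  push_cast
  ring

theorem Per_eq_desourcification (Λ : KGraph.{u} k) (hΛ : Λ.LocallyConvex) :
    Λ.Per = (Λ.desourcification hΛ).Per :=
  (Λ.Per_subset_desourcification hΛ).antisymm (Λ.desourcification_Per_subset hΛ)

theorem Per_zero_mem {Λ : KGraph.{u} k} (v : Λ.Path) : 0 ∈ Λ.Per :=
  ⟨v, v, ⟨rfl, fun _ _ _ => rfl⟩, by funext i; simp⟩

theorem Per_neg_mem {Λ : KGraph.{u} k} {z : Fin k → ℤ} (hz : z ∈ Λ.Per) : -z ∈ Λ.Per := by
  obtain ⟨μ, ν, h, rfl⟩ := hz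
  exact ⟨ν, μ, h.symm, by funext i; simp⟩

/-- Periods add up if any two vertices of `Λ` have a common descendant. -/
theorem Per_add_mem {Λ : KGraph.{u} k} (hΛ : Λ.LocallyConvex)
    (hdir : ∀ v ∈ Λ.vertices, ∀ w ∈ Λ.vertices, ∃ μ ν, Λ.r μ = v ∧ Λ.r ν = w ∧ Λ.s μ = Λ.s ν)
    {z z' : Fin k → ℤ} (hz : z ∈ Λ.Per) (hz' : z' ∈ Λ.Per) : z + z' ∈ Λ.Per := by
  obtain ⟨μ, ν, h, rfl⟩ := hz
  obtain ⟨μ', ν', h', rfl⟩ := hz'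
  obtain ⟨γ, γ', hγ, hγ', hs⟩ := hdir _ (Λ.d_s μ) _ (Λ.d_s μ')
  -- Using the same `x` for both pairs gives all the resulting elements of the desourcification the
  -- source `[x;(0,0)]`, as `Per.add_mem` requires.
  obtain ⟨x, hx, hr⟩ := hΛ.exists_boundary (Λ.s γ) (Λ.d_s γ)
  have h1 := h.comp_right hΛ hγ.symm
  have h1' := h'.comp_right hΛ hγ'.symm
  have r1 := (Λ.s_comp μ γ hγ.symm).trans hr.symm
  have r2 := (Λ.s_comp μ' γ' hγ'.symm).trans (hs.symm.trans hr.symm)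
  have p1 := DPath.pathEquiv_mk_concat (hΛ := hΛ) h1 hx r1 (h1.1.symm.trans r1)
  have p2 := DPath.pathEquiv_mk_concat (hΛ := hΛ) h1' hx r2 (h1'.1.symm.trans r2)
  have s1 := DPath.s_mk_concat r1 (hx.concat hΛ _ r1) hx
  have s2 := DPath.s_mk_concat r2 (hx.concat hΛ _ r2) hx
  rw [Per_eq_desourcification Λ hΛ]
  have := Per.add_mem (fun _ hz => hz.deg_eq_top_of_desourcification) p1 p2 (s1.trans s2.symm)
    (x := ExtPath.lift hΛ x hx) rfl s1.symm
  convert this using 1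
  funext i
  have e : ∀ n : Fin k → ℕ, n - 0 = n := fun n => tsub_zero n
  change _ = (((Λ.d _ - 0) i : ℕ) - ((Λ.d _ - 0) i : ℕ) : ℤ) +
    (((Λ.d _ - 0) i : ℕ) - ((Λ.d _ - 0) i : ℕ) : ℤ)
  rw [e, e, e, e, Λ.d_comp, Λ.d_comp, Λ.d_comp, Λ.d_comp]
  simp only [Pi.add_apply]
  push_cast
  ring

end KGraph

theorem corollary3p7 {k : ℕ} (Λ : KGraph.{u} k) (hlc : Λ.LocallyConvex) (hrf : Λ.RowFinite) :
    Λ.Per = (Λ.desourcification hlc).Per ∧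
      (Λ.IsMaximalTail Λ.vertices → ∃ G : AddSubgroup (Fin k → ℤ), (G : Set (Fin k → ℤ)) = Λ.Per) := by
  refine ⟨Λ.Per_eq_desourcification hlc, fun hT => ?_⟩
  obtain ⟨v, -⟩ := hT.nonempty
  exact ⟨{ carrier := Λ.Per
           zero_mem' := KGraph.Per_zero_mem v
           add_mem' := KGraph.Per_add_mem hlc hT.directed
           neg_mem' := KGraph.Per_neg_mem }, rfl⟩
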